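/- **Setting.** Let $K\ge 1$, $[K]=\{1,\dots,K\}$, and let $(\xi_t,J_t)_{t\ge0}$ be a càdlàg Markov additive process on $\mathbb R\times[K]$ without killing and with $\xi$ non-decreasing: under $\mathbb P_{(x,i)}$ it starts at $(x,i)$, and for all $t\ge 0$, conditionally on $(\xi_u,J_u)_{u\le t}$, the process $(\xi_{t+s}-\xi_t,J_{t+s})_{s\ge0}$ has the law of $(\xi,J)$ under $\mathbb P_{(0,J_t)}$. Write $\mathbb P_i=\mathbb P_{(0,i)}$. Its parameters are the transition rate matrix $\mathbf\Lambda=(\lambda_{i,j})$ of $J$; the laws $B_{i,j}$ on $[0,\infty)$ of the jump of $\xi$ when $J$ jumps from $i$ to $j\ne i$ (with $B_{i,i}=\delta_0$); and, for each $i\in[K]$, the drift $c^{(i)}\ge0$ and Lévy measure $\Pi^{(i)}$ on $(0,\infty)$, with $\int(1\wedge x)\,\Pi^{(i)}(dx)<\infty$, of the subordinator which $\xi$ follows while $J=i$. Equivalently, the infinitesimal generator of $(\xi,J)$ is $$\mathcal Af(x,i)=c^{(i)}\partial_xf(x,i)+\int_{(0,\infty)}\big(f(x+y,i)-f(x,i)\big)\Pi^{(i)}(dy)+\sum_{j}\lambda_{i,j}\int_{[0,\infty)}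 f(x+y,j)\,B_{i,j}(dy)$$ on functions $f$ which are bounded and $C^1$ with bounded derivative in $x$. Assume that $\mathbf\Lambda$ is irreducible and that $\xi$ is not constant, i.e. $c^{(i)}>0$ or $\Pi^{(i)}\neq0$ for some $i$, or $\lambda_{i,j}>0$ and $B_{i,j}((0,\infty))>0$ for some $i\ne j$. Let $$\underline p=\inf\Big\{p\in\mathbb R:\ \forall i,\ \int_{(0,\infty)}(e^{-px}-1)\,\Pi^{(i)}(dx)<\infty\ \text{ and }\ \forall i,j,\ \lambda_{i,j}\int_{[0,\infty)} e^{-px}B_{i,j}(dx)<\infty\Big\}\in[-\infty,0]$$ and assume $\underline p<0$. For $p>\underline p$ let $\mathbf\Phi(p)$ be the $K\times K$ matrix with entries $$\mathbf\Phi(p)_{i,j}=\mathbf 1_{\{i=j\}}\Big(c^{(i)}p+\int_{(0,\infty)}(1-e^{-px})\,\Pi^{(i)}(dx)\Big)-\lambda_{i,j}\int_{[0,\infty)} e^{-px}B_{i,j}(dx).$$ Let $I_\xi=\int_0^\infty e^{-\xi_t}\,dt$, and let $\mathbf N(p)$ be the column vector with entries $\mathbf N(p)_i=\mathbb E_i[I_\xi^p]$.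 Let $\mathbf 1$ be the column vector with all entries $1$. **Proposition (negative moments).** For every $i\in[K]$, $0<I_\xi<\infty$ $\mathbb P_i$-almost surely, and: (i) The matrix function $\mathbf\Phi$ is differentiable at $0$, and for all $i,j$ and $t\ge 0$ the variable $\xi_t$ is $\mathbb P_i$-integrable with $\mathbf\Phi'(0)_{i,j}=\lim_{t\downarrow0}t^{-1}\,\mathbb E_i[\xi_t\mathbf 1_{\{J_t=j\}}]$. The variable $\ln I_\xi$ is $\mathbb P_i$-integrable for all $i$, the vector $\mathbf N(p)$ has finite entries for $p$ in a neighbourhood of $0$ and is differentiable at $0$, with $\mathbf N'(0)_i=\mathbb E_i[\ln I_\xi]$. The entries of $\mathbf N(-1)$ are finite, and $$\mathbf N(-1)=\mathbf\Phi'(0)\mathbf 1-\mathbf\Lambda\,\mathbf N'(0).$$ (ii) For every integer $k<0$ with $k>\underline p-1$, the entries of $\mathbf N(k)$ are finite, and $$\mathbf N(k)=\frac{(-1)^{k+1}}{(|k|-1)!}\,\mathbf\Phi(k+1)\,\mathbf\Phi(k+2)\cdots\mathbf\Phi(-1)\,\mathbf N(-1),$$ where the product of matrices is the identity when $k=-1$.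 -/

import Mathlib

open MeasureTheory Filter Topology
open scoped NNReal ENNReal Matrix

/-- The parameters of a non-decreasing Markov additive process without killing, with types in
`Fin K`: the transition rate matrix `rate` of the chain of types, the laws `jump i j` on `[0, ∞)`
of the jump of the position when the type jumps from `i` to `j`, and, for each type `i`, the drift
`drift i` and the Lévy measure `levy i` of the subordinator followed while the type is `i`
(a measure on `(0, ∞)` integrating `1 ∧ x`, hence `σ`-finite). -/
structure MAPData (K : ℕ) where
  rate : Matrix (Fin K) (Fin K) ℝ
  rate_nonneg : ∀ i j, i ≠ j → 0 ≤ rate i j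
  rate_row_sum : ∀ i, ∑ j, rate i j = 0
  jump : Fin K → Fin K → Measure ℝ
  jump_prob : ∀ i j, IsProbabilityMeasure (jump i j)
  jump_support : ∀ i j, jump i j (Set.Iio 0) = 0
  jump_diag : ∀ i, jump i i = Measure.dirac 0
  drift : Fin K → ℝ
  drift_nonneg : ∀ i, 0 ≤ drift i
  levy : Fin K → Measure ℝ
  levy_support : ∀ i, levy i (Set.Iic 0) = 0
  levy_integrable : ∀ i, ∫⁻ x, ENNReal.ofReal (min 1 x) ∂(levy i) < ∞

namespace MAPData

variable {K : ℕ} (D : MAPData K)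

/-- The Laplace exponent `ψ_i(p) = c_i p + ∫ (1 - e^{-px}) Π_i(dx)` (no killing). -/
noncomputable def laplaceExponent (i : Fin K) (p : ℝ) : ℝ :=
  D.drift i * p + ∫ x, (1 - Real.exp (-p * x)) ∂(D.levy i)

/-- The Bernstein matrix `Φ(p) = diag(ψ_i(p)) - Λ ∘ B̂(p)`. -/
noncomputable def bernstein (p : ℝ) : Matrix (Fin K) (Fin K) ℝ :=
  Matrix.of fun i j =>
    (if i = j then D.laplaceExponent i p else 0)
      - D.rate i j * ∫ x, Real.exp (-p * x) ∂(D.jump i j)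

/-- The infimum (in `[-∞, +∞]`) of the real `p` at which the integrals defining `Φ(p)` are finite.
For `p ≥ 0` the first integrand is nonpositive, so its positive part is `0`; a vanishing rate
makes the second condition void. -/
noncomputable def pLower : EReal :=
  sInf ((fun p : ℝ => (p : EReal)) ''
    {p : ℝ | (∀ i, ∫⁻ x, ENNReal.ofReal (Real.exp (-p * x) - 1) ∂(D.levy i) < ∞) ∧
      ∀ i j, ENNReal.ofReal (D.rate i j) *
        ∫⁻ x, ENNReal.ofReal (Real.exp (-p * x)) ∂(D.jump i j) < ∞})

/-- Any two types are joined by a finite sequence of transitions with positive rates. -/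
def Irreducible : Prop :=
  ∀ i j, Relation.ReflTransGen (fun a b => 0 < D.rate a b) i j

/-- The position component is not constant: some subordinator is non-trivial, or some transition
that does occur moves the position with positive probability. -/
def NonConstant : Prop :=
  (∃ i, 0 < D.drift i ∨ D.levy i ≠ 0) ∨
    ∃ i j, i ≠ j ∧ 0 < D.rate i j ∧ 0 < D.jump i j (Set.Ioi 0)

/-- The infinitesimal generator attached to the parameters, applied to `f` at `(x, i)`:
`c_i f_i'(x) + ∫ (f_i(x+y) - f_i(x)) Π_i(dy) + ∑_j λ_{ij} ∫ f_j(x+y) B_{ij}(dy)`.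
The term `j = i` of the last sum is `λ_{ii} f_i(x)`. -/
noncomputable def generator (f : Fin K → ℝ → ℝ) (x : ℝ) (i : Fin K) : ℝ :=
  D.drift i * deriv (f i) x + (∫ y, (f i (x + y) - f i x) ∂(D.levy i))
    + ∑ j, D.rate i j * ∫ y, f j (x + y) ∂(D.jump i j)

end MAPData

section MarkovAdditive

variable {K : ℕ} {Ω : Type*} [MeasurableSpace Ω]

/-- The `σ`-algebra generated by the positions and types up to time `t`. -/
abbrev pastSigma (ξ : ℝ≥0 → Ω → ℝ) (J : ℝ≥0 → Ω → Fin K) (t : ℝ≥0) : MeasurableSpace Ω :=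
  ⨆ u : Set.Iic t, MeasurableSpace.comap (fun ω => (ξ u ω, J u ω)) inferInstance

/-- `(ξ, J)` is, under the laws `P x i` (start at position `x` with type `i`), a càdlàg Markov
additive process on `ℝ × Fin K` without killing, with non-decreasing position: for every `t`,
conditionally on the past up to `t`, the process `(ξ_{t+s} - ξ_t, J_{t+s})_{s ≥ 0}` has the law of
`(ξ, J)` under `P 0 (J_t)`. -/
structure IsMAP (P : ℝ → Fin K → Measure Ω) (ξ : ℝ≥0 → Ω → ℝ) (J : ℝ≥0 → Ω → Fin K) : Prop where
  prob : ∀ x i, IsProbabilityMeasure (P x i)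
  measurable_pos : ∀ t, Measurable (ξ t)
  measurable_type : ∀ t, Measurable (J t)
  start : ∀ x i, ∀ᵐ ω ∂(P x i), ξ 0 ω = x ∧ J 0 ω = i
  monotone_pos : ∀ ω, Monotone fun t => ξ t ω
  right_cont : ∀ ω t, ContinuousWithinAt (fun s => (ξ s ω, J s ω)) (Set.Ici t) t
  left_lim : ∀ ω t, ∃ l, Tendsto (fun s => (ξ s ω, J s ω)) (𝓝[<] t) (𝓝 l)
  additive : ∀ (x : ℝ) (i : Fin K) (t : ℝ≥0) (A : Set Ω) (S : Set (ℝ≥0 → ℝ × Fin K)),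
    MeasurableSet[pastSigma ξ J t] A → MeasurableSet S →
    P x i (A ∩ {ω | (fun s => (ξ (t + s) ω - ξ t ω, J (t + s) ω)) ∈ S})
      = ∫⁻ ω in A, P 0 (J t ω) {ω' | (fun s => (ξ s ω', J s ω')) ∈ S} ∂(P x i)

/-- The process has the parameters `D`: its infinitesimal generator, on the functions of position
and type that are bounded and `C¹` with bounded derivative in the position, is the one attached
to `D`. -/
def HasParameters (P : ℝ → Fin K → Measure Ω) (ξ : ℝ≥0 → Ω → ℝ) (J : ℝ≥0 → Ω → Fin K)
    (D : MAPData K) : Prop :=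
  ∀ f : Fin K → ℝ → ℝ, (∀ j, ContDiff ℝ 1 (f j)) →
    (∃ C, ∀ j x, |f j x| ≤ C ∧ |deriv (f j) x| ≤ C) →
    ∀ (x : ℝ) (i : Fin K),
      Tendsto (fun t : ℝ≥0 => ((∫ ω, f (J t ω) (ξ t ω) ∂(P x i)) - f i x) / (t : ℝ))
        (𝓝[>] 0) (𝓝 (D.generator f x i))

/-- The exponential functional `I_ξ = ∫_0^∞ e^{-ξ_t} dt`, with values in `[0, ∞]`. -/
noncomputable def expFunctional (ξ : ℝ≥0 → Ω → ℝ) (ω : Ω) : ℝ≥0∞ :=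
  ∫⁻ t in Set.Ioi (0 : ℝ), ENNReal.ofReal (Real.exp (-ξ t.toNNReal ω))

/-- The moment `N(p)_i = E_i[I_ξ^p]`, with values in `[0, ∞]`, under the law started at `(0, i)`. -/
noncomputable def moment (P : ℝ → Fin K → Measure Ω) (ξ : ℝ≥0 → Ω → ℝ) (p : ℝ) (i : Fin K) :
    ℝ≥0∞ :=
  ∫⁻ ω, expFunctional ξ ω ^ p ∂(P 0 i)

/-- The vector `N(p)` with real entries; used together with the finiteness of `moment P ξ p i`. -/
noncomputable def momentVec (P : ℝ → Fin K → Measure Ω) (ξ : ℝ≥0 → Ω → ℝ) (p : ℝ) : Fin K → ℝ :=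
  fun i => (moment P ξ p i).toReal

/-- `E_i[ln I_ξ]`; used together with `I_ξ < ∞` a.s. and the integrability of `ln I_ξ`. -/
noncomputable def logMoment (P : ℝ → Fin K → Measure Ω) (ξ : ℝ≥0 → Ω → ℝ) : Fin K → ℝ :=
  fun i => ∫ ω, Real.log (expFunctional ξ ω).toReal ∂(P 0 i)

end MarkovAdditive

/-! Write `I` for the exponential functional and `I_t` for its tail after time `t`. Since `I_t =
e^{-ξ_t} I'`, where `I'` is the functional of the shifted path, a primitive `φ` of `x^{-q-1}`
satisfies `φ(I) - φ(I_t) = ∫_0^t I_s^{-q-1} e^{-ξ_s} ds`, and the integrand is `e^{qξ_s}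
(I')^{-q-1}` with `I'` taken after time `s`. The Markov property turns the expectation into `∫_0^t
Σ_j E_i[e^{qξ_s}; J_s = j] N(-q-1)_j ds` (`lintegral_sub_tail`). Dividing by `t` and letting `t → 0`
isolates `N(-q-1)_i` (`moment_eq_of_tendsto`).

The left side is computed with the same factorisation. For `q > 0` and `φ = -x^{-q}/q` it yields
`N(-q-1) = -q⁻¹ Φ(-q) N(-q)` (`moment_step`); for `q = 0` and `φ = log` it yields the base case
(`moment_neg_one`). Iterating gives (ii).

Two inputs remain. First, `E_i[e^{qξ_t}; J_t = j]` must have derivative `-Φ(-q)_{ij}` at `t = 0`,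
although `e^{qx}` is not an admissible test function for the generator. Bounded submultiplicative
truncations give a bound `e^{Ct}` on the moments (`lintegral_exp_le`), which makes the truncation
error in the difference quotient small uniformly in `t`, so that the limits may be exchanged
(`tendsto_div_of_approx`). Second, `E_i[I]` is finite: irreducibility and non-constancy give
`E_i[e^{-ξ_T}] ≤ a < 1` for all types at some `T`, and `I` is dominated by a geometric series in
mean. With `I ≥ e^{-ξ_1}` this puts `0` in the interior of the domain of the moment generating
function of `ln I`. -/

/-! ### Elementary exponential inequalities -/

theorem mul_exp_le_exp_sub_one_div {q δ x : ℝ} (hq : 0 ≤ q) (hδ : 0 < δ) (hx : 0 ≤ x) :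
    x * Real.exp (q * x) ≤ (Real.exp ((q + δ) * x) - 1) / δ := by
  have h1 : δ * x ≤ Real.exp (δ * x) - 1 := by linarith [Real.add_one_le_exp (δ * x)]
  have h2 : 1 ≤ Real.exp (q * x) := Real.one_le_exp (by positivity)
  have h3 : Real.exp ((q + δ) * x) = Real.exp (q * x) * Real.exp (δ * x) := by
    rw [← Real.exp_add]; ring_nf
  rw [le_div_iff₀ hδ, h3]
  nlinarith

/-- Each power of `x` costs one margin `δ` in the exponent. The `- 1` matters: the bound vanishes at
`0`, so its expectation at `ξ_t` is `O(t)`. -/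
theorem sq_mul_exp_le_exp_sub_one_div {q δ x : ℝ} (hq : 0 ≤ q) (hδ : 0 < δ) (hx : 0 ≤ x) :
    x ^ 2 * Real.exp (q * x) ≤ (Real.exp ((q + δ + δ) * x) - 1) / δ ^ 2 := by
  have h1 := mul_exp_le_exp_sub_one_div hq hδ hx
  have h2 := mul_exp_le_exp_sub_one_div (add_nonneg hq hδ.le) hδ hx
  calc x ^ 2 * Real.exp (q * x) = x * (x * Real.exp (q * x)) := by ring
    _ ≤ x * ((Real.exp ((q + δ) * x) - 1) / δ) := by gcongr
    _ ≤ (x * Real.exp ((q + δ) * x)) / δ := by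
        rw [← mul_div_assoc]; gcongr; linarith
    _ ≤ ((Real.exp ((q + δ + δ) * x) - 1) / δ) / δ := by gcongr
    _ = _ := by rw [div_div, sq]

theorem hasDerivAt_exp_neg_mul (p x : ℝ) :
    HasDerivAt (fun p => Real.exp (-p * x)) (-(x * Real.exp (-p * x))) p := by
  convert ((hasDerivAt_neg p).mul_const x).exp using 1
  ring

/-! ### Exponential moments of the parameters and differentiability of `Φ` -/

namespace MAPData

variable {K : ℕ}

/-- Exponential moments of order `Q` of the Lévy measures and of the relevant jump laws. -/
def ExpMoment (D : MAPData K) (Q : ℝ) : Prop :=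
  (∀ i, Integrable (fun x => Real.exp (Q * x) - 1) (D.levy i)) ∧
    ∀ i j, D.rate i j ≠ 0 → Integrable (fun x => Real.exp (Q * x)) (D.jump i j)

theorem ae_levy_pos (D : MAPData K) (i : Fin K) : ∀ᵐ x ∂(D.levy i), 0 < x := by
  rw [ae_iff]; simp only [not_lt]; exact D.levy_support i

theorem ae_jump_nonneg (D : MAPData K) (i j : Fin K) : ∀ᵐ x ∂(D.jump i j), 0 ≤ x := by
  rw [ae_iff]; simp only [not_le]; exact D.jump_support i j

/-- The infimum is strictly below `p`, so some admissible `r` lies strictly between; `Q = -r` then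
leaves room for dominated convergence. -/
theorem exists_expMoment (D : MAPData K) {p : ℝ} (hp : p ≤ 0) (h : D.pLower < (p : EReal)) :
    ∃ Q, -p < Q ∧ D.ExpMoment Q := by
  obtain ⟨_, ⟨r, ⟨hr1, hr2⟩, rfl⟩, hr⟩ := sInf_lt_iff.1 h
  have hrp : r < p := EReal.coe_lt_coe_iff.1 hr
  refine ⟨-r, by linarith, fun i => ?_, fun i j hij => ?_⟩
  · refine ⟨(by fun_prop), ?_⟩
    rw [hasFiniteIntegral_iff_ofReal]
    · exact hr1 i
    · filter_upwards [D.ae_levy_pos i] with x hx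
      have : 1 ≤ Real.exp (-r * x) := Real.one_le_exp (by nlinarith)
      simpa using this
  -- A diagonal rate is not positive, so its finiteness condition says nothing; there the jump law
  -- is a Dirac mass anyway.
  · by_cases hd : i = j
    · subst hd
      rw [D.jump_diag]
      exact integrable_dirac (by simp)
    · refine ⟨(by fun_prop), ?_⟩
      rw [hasFiniteIntegral_iff_ofReal (ae_of_all _ fun x => (Real.exp_pos _).le)]
      have hpos : 0 < D.rate i j := lt_of_le_of_ne (D.rate_nonneg i j hd) (Ne.symm hij)
      have h2 := hr2 i j
      by_contra hcon
      rw [not_lt, top_le_iff] at hcon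
      rw [hcon, ENNReal.mul_top (by simpa using hpos)] at h2
      exact lt_irrefl _ h2

theorem ExpMoment.integrable_levy_of_le {D : MAPData K} {Q : ℝ} (hQ : D.ExpMoment Q) {f : ℝ → ℝ}
    (hf : Measurable f) {C : ℝ} (hb : ∀ x, 0 < x → |f x| ≤ C * (Real.exp (Q * x) - 1)) (i : Fin K) :
    Integrable f (D.levy i) := by
  refine ((hQ.1 i).const_mul C).mono' hf.aestronglyMeasurable ?_
  filter_upwards [D.ae_levy_pos i] with x hx using hb x hx

theorem ExpMoment.integrable_jump_of_le {D : MAPData K} {Q : ℝ} (hQ : D.ExpMoment Q) {f : ℝ → ℝ}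
    (hf : Measurable f) {C : ℝ} (hb : ∀ x, 0 ≤ x → |f x| ≤ C * Real.exp (Q * x)) (i j : Fin K)
    (hij : D.rate i j ≠ 0) : Integrable f (D.jump i j) := by
  refine ((hQ.2 i j hij).const_mul C).mono' hf.aestronglyMeasurable ?_
  filter_upwards [D.ae_jump_nonneg i j] with x hx using hb x hx

/-- The derivative at `0` of the Bernstein matrix. -/
noncomputable def bernsteinDeriv (D : MAPData K) : Matrix (Fin K) (Fin K) ℝ :=
  Matrix.of fun i j => (if i = j then D.drift i + ∫ x, x ∂(D.levy i) else 0)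
    + D.rate i j * ∫ x, x ∂(D.jump i j)

theorem ExpMoment.hasDerivAt_bernstein {D : MAPData K} {Q : ℝ} (hQ0 : 0 < Q)
    (hQ : D.ExpMoment Q) (i j : Fin K) :
    HasDerivAt (fun p => D.bernstein p i j) (D.bernsteinDeriv i j) 0 := by
  have hexp : ∀ p ∈ Metric.ball (0 : ℝ) (Q / 2), ∀ x : ℝ, 0 ≤ x →
      |x * Real.exp (-p * x)| ≤ x * Real.exp (Q / 2 * x) := by
    intro p hp x hx
    rw [Metric.mem_ball, dist_zero_right, Real.norm_eq_abs, abs_lt] at hp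
    rw [abs_of_nonneg (by positivity)]
    gcongr
    linarith
  have hbd : ∀ x : ℝ, 0 ≤ x →
      x * Real.exp (Q / 2 * x) ≤ (Q / 2)⁻¹ * (Real.exp (Q * x) - 1) := by
    intro x hx
    have := mul_exp_le_exp_sub_one_div (q := Q / 2) (δ := Q / 2) (by positivity) (by positivity) hx
    rw [add_halves] at this
    rwa [inv_mul_eq_div]
  have hball : Metric.ball (0 : ℝ) (Q / 2) ∈ 𝓝 (0 : ℝ) := Metric.ball_mem_nhds _ (by positivity)
  have h1 : HasDerivAt (fun p => ∫ x, (1 - Real.exp (-p * x)) ∂(D.levy i))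
      (∫ x, x ∂(D.levy i)) 0 := by
    have := (hasDerivAt_integral_of_dominated_loc_of_deriv_le (μ := D.levy i) (x₀ := (0 : ℝ))
      (F := fun p x => 1 - Real.exp (-p * x)) (F' := fun p x => x * Real.exp (-p * x))
      (bound := fun x => x * Real.exp (Q / 2 * x)) hball
      (Eventually.of_forall fun p => by fun_prop) (by simp) (by fun_prop)
      (by
        filter_upwards [D.ae_levy_pos i] with x hx p hp using hexp p hp x hx.le)
      (hQ.integrable_levy_of_le (C := (Q / 2)⁻¹) (by fun_prop) (fun x hx => by
        rw [abs_of_nonneg (by positivity)]; exact hbd x hx.le) i)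
      (ae_of_all _ fun x p _ => by
        simpa using (hasDerivAt_exp_neg_mul p x).const_sub 1)).2
    simpa using this
  have h2 : HasDerivAt (fun p => D.rate i j * ∫ x, Real.exp (-p * x) ∂(D.jump i j))
      (- (D.rate i j * ∫ x, x ∂(D.jump i j))) 0 := by
    by_cases hij : D.rate i j = 0
    · simpa [hij] using hasDerivAt_const (0 : ℝ) (0 : ℝ)
    have := D.jump_prob i j
    have := (hasDerivAt_integral_of_dominated_loc_of_deriv_le (μ := D.jump i j) (x₀ := (0 : ℝ))
      (F := fun p x => Real.exp (-p * x)) (F' := fun p x => - (x * Real.exp (-p * x)))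
      (bound := fun x => x * Real.exp (Q / 2 * x)) hball
      (Eventually.of_forall fun p => by fun_prop) (by simp) (by fun_prop)
      (by
        filter_upwards [D.ae_jump_nonneg i j] with x hx p hp
        rw [norm_neg]; exact hexp p hp x hx)
      (hQ.integrable_jump_of_le (C := (Q / 2)⁻¹) (by fun_prop) (fun x hx => by
        rw [abs_of_nonneg (by positivity)]
        refine (hbd x hx).trans ?_
        gcongr; linarith) i j hij)
      (ae_of_all _ fun x p _ => by
        exact hasDerivAt_exp_neg_mul p x)).2
    have h3 := this.const_mul (D.rate i j)
    rw [integral_neg, mul_neg] at h3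
    simpa using h3
  unfold bernstein laplaceExponent bernsteinDeriv
  simp only [Matrix.of_apply]
  rw [show ∀ a b : ℝ, a + b = a - -b from fun a b => by ring]
  refine HasDerivAt.sub ?_ h2
  by_cases hij : i = j
  · simp only [hij, if_true]
    subst hij
    have h3 := ((hasDerivAt_id (0 : ℝ)).const_mul (D.drift i)).add h1
    rw [mul_one] at h3
    exact h3
  · simpa [hij] using hasDerivAt_const (0 : ℝ) (0 : ℝ)

theorem bernstein_zero (D : MAPData K) : D.bernstein 0 = -D.rate := by
  ext i j
  have := D.jump_prob i j
  simp [bernstein, laplaceExponent]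

end MAPData

/-! ### Truncated exponentials as test functions -/

/-- A bounded smooth submultiplicative substitute for `x ↦ exp (q * x)`, tending to it as
`a → 0`. -/
noncomputable def truncExp (a q x : ℝ) : ℝ := Real.exp (q * ((1 - Real.exp (-a * x)) / a))

namespace truncExp

variable {a q : ℝ}

theorem pos (x : ℝ) : 0 < truncExp a q x := Real.exp_pos _

@[simp] theorem apply_zero : truncExp a q 0 = 1 := by simp [truncExp]

theorem contDiff : ContDiff ℝ 1 (truncExp a q) := by
  unfold truncExp; fun_prop

theorem measurable : Measurable (truncExp a q) := contDiff.continuous.measurable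

theorem le_exp (ha : 0 < a) (hq : 0 ≤ q) (x : ℝ) : truncExp a q x ≤ Real.exp (q * x) := by
  unfold truncExp
  gcongr
  rw [div_le_iff₀ ha]
  linarith [Real.add_one_le_exp (-a * x)]

theorem le_bound (ha : 0 < a) (hq : 0 ≤ q) (x : ℝ) : truncExp a q x ≤ Real.exp (q / a) := by
  unfold truncExp
  rw [← mul_div_assoc]
  gcongr
  nlinarith [Real.exp_pos (-a * x)]

theorem one_le (ha : 0 < a) (hq : 0 ≤ q) {x : ℝ} (hx : 0 ≤ x) : 1 ≤ truncExp a q x := by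
  refine Real.one_le_exp (mul_nonneg hq (div_nonneg ?_ ha.le))
  have : Real.exp (-a * x) ≤ 1 := Real.exp_le_one_iff.2 (by nlinarith)
  linarith

/-- The exponent `(1 - e^{-ax})/a` is subadditive on `[0, ∞)`, because `(1 - e^{-ax})(1 - e^{-ay}) ≥
0`. -/
theorem add_le_mul (ha : 0 < a) (hq : 0 ≤ q) {x y : ℝ} (hx : 0 ≤ x) (hy : 0 ≤ y) :
    truncExp a q (x + y) ≤ truncExp a q x * truncExp a q y := by
  unfold truncExp
  rw [← Real.exp_add, ← mul_add, ← add_div]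
  gcongr
  have h1 : Real.exp (-a * x) ≤ 1 := Real.exp_le_one_iff.2 (by nlinarith)
  have h2 : Real.exp (-a * y) ≤ 1 := Real.exp_le_one_iff.2 (by nlinarith)
  rw [mul_add, Real.exp_add]
  nlinarith

theorem hasDerivAt (ha : 0 < a) (x : ℝ) :
    HasDerivAt (truncExp a q) (q * Real.exp (-a * x) * truncExp a q x) x := by
  have h1 : HasDerivAt (fun y : ℝ => Real.exp (-a * y)) (Real.exp (-a * x) * (-a * 1)) x :=
    ((hasDerivAt_id x).const_mul (-a)).exp
  have h2 := (((h1.const_sub 1).div_const a).const_mul q).exp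
  unfold truncExp
  convert h2 using 1
  field_simp

/-- With `u = q e^{-ax}/a` the derivative is `a u e^{-u} e^{q/a}`, and `u e^{-u} ≤ 1`. The bound has
to hold on all of `ℝ`, since test functions are bounded there. -/
theorem abs_deriv_le (ha : 0 < a) (hq : 0 ≤ q) (x : ℝ) :
    |deriv (truncExp a q) x| ≤ a * Real.exp (q / a) := by
  rw [(hasDerivAt ha x).deriv, abs_of_nonneg (by have := pos (a := a) (q := q) x; positivity)]
  unfold truncExp
  set z := Real.exp (-a * x)
  have h1 : q * ((1 - z) / a) = q / a + -(q * z / a) := by ring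
  have h2 : q * z / a ≤ Real.exp (q * z / a) := by linarith [Real.add_one_le_exp (q * z / a)]
  rw [h1, Real.exp_add, Real.exp_neg]
  have h3 : q * z * (Real.exp (q * z / a))⁻¹ ≤ a := by
    rw [← div_eq_mul_inv, div_le_iff₀ (Real.exp_pos _)]
    rw [div_le_iff₀ ha] at h2
    linarith
  calc _ = (q * z * (Real.exp (q * z / a))⁻¹) * Real.exp (q / a) := by ring
    _ ≤ _ := by gcongr

/-- The exponents differ by at most `q a x²`, and `1 - e^{-u} ≤ u`. The error is linear in `a`. -/
theorem exp_sub_le (ha : 0 < a) (hq : 0 ≤ q) {x : ℝ} (hx : 0 ≤ x) :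
    Real.exp (q * x) - truncExp a q x ≤ q * a * (x ^ 2 * Real.exp (q * x)) := by
  unfold truncExp
  set g := (1 - Real.exp (-a * x)) / a with hg
  have h1 : Real.exp (q * g) = Real.exp (q * x) * Real.exp (-(q * (x - g))) := by
    rw [← Real.exp_add]; ring_nf
  have h2 : 1 - q * (x - g) ≤ Real.exp (-(q * (x - g))) := by
    linarith [Real.add_one_le_exp (-(q * (x - g)))]
  have h3 : x - g ≤ a * x ^ 2 := by
    rw [hg, sub_le_iff_le_add, ← sub_le_iff_le_add', le_div_iff₀ ha]
    have h4 : Real.exp (-a * x) ≤ (1 + a * x)⁻¹ := by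
      rw [neg_mul, Real.exp_neg]
      have : 0 ≤ a * x := by positivity
      gcongr
      linarith [Real.add_one_le_exp (a * x)]
    have h5 : (1 + a * x)⁻¹ ≤ 1 - a * x + (a * x) ^ 2 := by
      have : 0 ≤ a * x := by positivity
      rw [inv_le_iff_one_le_mul₀ (by positivity)]
      nlinarith [pow_nonneg this 3]
    nlinarith
  rw [h1]
  have h6 : q * (x - g) ≤ q * (a * x ^ 2) := by gcongr
  nlinarith [Real.exp_pos (q * x)]

theorem tendsto (hq : 0 ≤ q) {x : ℝ} (hx : 0 ≤ x) :
    Tendsto (fun a => truncExp a q x) (𝓝[>] 0) (𝓝 (Real.exp (q * x))) := by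
  have h : Tendsto (fun a => Real.exp (q * x) - q * a * (x ^ 2 * Real.exp (q * x))) (𝓝[>] 0)
      (𝓝 (Real.exp (q * x))) := by
    refine (Continuous.tendsto' (by fun_prop) 0 _ (by simp)).mono_left nhdsWithin_le_nhds
  refine tendsto_of_tendsto_of_tendsto_of_le_of_le' h tendsto_const_nhds ?_ ?_
  · filter_upwards [self_mem_nhdsWithin] with a ha
    linarith [exp_sub_le ha hq hx]
  · filter_upwards [self_mem_nhdsWithin] with a ha using le_exp ha hq x

end truncExp

/-! ### The generator on truncated exponentials -/

namespace MAPData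

variable {K : ℕ}

/-- The generator at position `0` on functions charging a single type. -/
theorem generator_single (D : MAPData K) (h : ℝ → ℝ) (i j : Fin K) :
    D.generator (fun j' => if j' = j then h else fun _ => 0) 0 i =
      (if i = j then D.drift i * deriv h 0 + ∫ y, (h y - h 0) ∂(D.levy i) else 0)
        + D.rate i j * ∫ y, h y ∂(D.jump i j) := by
  unfold generator
  rw [Finset.sum_eq_single j]
  · by_cases hij : i = j <;> simp [hij]
  · intro b _ hb; simp [hb]
  · simp

/-- Dominated convergence with dominating functions `e^{Qx} - 1` for the Lévy measures, which may be
infinite, and `e^{Qx}` for the jump laws. -/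
theorem ExpMoment.tendsto_generator_truncExp {D : MAPData K} {q Q : ℝ} (hq : 0 ≤ q) (hqQ : q < Q)
    (hQ : D.ExpMoment Q) (i j : Fin K) :
    Tendsto (fun a => D.generator (fun j' => if j' = j then truncExp a q else fun _ => 0) 0 i)
      (𝓝[>] 0) (𝓝 (-D.bernstein (-q) i j)) := by
  simp_rw [generator_single]
  have hlim : -D.bernstein (-q) i j =
      (if i = j then D.drift i * q + ∫ y, (Real.exp (q * y) - 1) ∂(D.levy i) else 0)
        + D.rate i j * ∫ y, Real.exp (q * y) ∂(D.jump i j) := by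
    simp only [bernstein, laplaceExponent, Matrix.of_apply, neg_neg]
    have : ∫ y, (1 - Real.exp (q * y)) ∂(D.levy i) = - ∫ y, (Real.exp (q * y) - 1) ∂(D.levy i) := by
      rw [← integral_neg]; simp
    split_ifs
    · rw [this]; ring
    · ring
  rw [hlim]
  refine Tendsto.add ?_ ?_
  · by_cases hij : i = j
    · simp only [hij, if_true]
      subst hij
      refine Tendsto.add ?_ ?_
      · refine tendsto_const_nhds.congr' ?_
        filter_upwards [self_mem_nhdsWithin] with a ha
        rw [(truncExp.hasDerivAt ha 0).deriv]; simp
      · refine tendsto_integral_filter_of_dominated_convergence (fun x => Real.exp (Q * x) - 1)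
          (Eventually.of_forall fun a => (truncExp.measurable.sub_const _).aestronglyMeasurable) ?_
          (hQ.1 i) ?_
        · filter_upwards [self_mem_nhdsWithin] with a ha
          filter_upwards [D.ae_levy_pos i] with x hx
          rw [truncExp.apply_zero, Real.norm_eq_abs,
            abs_of_nonneg (by linarith [truncExp.one_le ha hq hx.le])]
          have : Real.exp (q * x) ≤ Real.exp (Q * x) := by gcongr
          linarith [truncExp.le_exp ha hq x]
        · filter_upwards [D.ae_levy_pos i] with x hx
          simpa using (truncExp.tendsto hq hx.le).sub_const 1
    · simp [hij]
  · by_cases hij : D.rate i j = 0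
    · simp [hij]
    refine Tendsto.const_mul _ ?_
    refine tendsto_integral_filter_of_dominated_convergence (fun x => Real.exp (Q * x))
          (Eventually.of_forall fun a => truncExp.measurable.aestronglyMeasurable) ?_
          (hQ.2 i j hij) ?_
    · filter_upwards [self_mem_nhdsWithin] with a ha
      filter_upwards [D.ae_jump_nonneg i j] with x hx
      rw [Real.norm_eq_abs, abs_of_pos (truncExp.pos x)]
      refine (truncExp.le_exp ha hq x).trans ?_
      gcongr
    · filter_upwards [D.ae_jump_nonneg i j] with x hx
      exact truncExp.tendsto hq hx

end MAPData

/-! ### Path functionals and the Markov property -/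

section

variable {K : ℕ} {Ω : Type*} [MeasurableSpace Ω]

/-- The path `s ↦ (ξ_s, J_s)`. -/
def mapPath (ξ : ℝ≥0 → Ω → ℝ) (J : ℝ≥0 → Ω → Fin K) (ω : Ω) : ℝ≥0 → ℝ × Fin K :=
  fun s => (ξ s ω, J s ω)

/-- The path after time `t`, with the position restarted from `0`. -/
def shiftedPath (ξ : ℝ≥0 → Ω → ℝ) (J : ℝ≥0 → Ω → Fin K) (t : ℝ≥0) (ω : Ω) : ℝ≥0 → ℝ × Fin K :=
  fun s => (ξ (t + s) ω - ξ t ω, J (t + s) ω)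

/-- Points of a grid of mesh `1 / (n + 1)` that approximate `t` from the right. -/
noncomputable def rightGrid (n : ℕ) (t : ℝ≥0) : ℝ≥0 := (⌊(n + 1 : ℝ≥0) * t⌋₊ + 1) / (n + 1)

theorem tendsto_rightGrid (t : ℝ≥0) : Tendsto (fun n => rightGrid n t) atTop (𝓝[≥] t) := by
  have hlt : ∀ n, t ≤ rightGrid n t := fun n => by
    unfold rightGrid
    rw [le_div_iff₀ (by positivity), mul_comm]
    exact (Nat.lt_floor_add_one _).le
  have hle : ∀ n, rightGrid n t ≤ t + 1 / (n + 1) := fun n => by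
    unfold rightGrid
    rw [add_div]
    gcongr
    rw [div_le_iff₀ (by positivity), mul_comm]
    exact Nat.floor_le (by positivity)
  refine tendsto_nhdsWithin_iff.2 ⟨?_, Eventually.of_forall hlt⟩
  refine tendsto_of_tendsto_of_tendsto_of_le_of_le tendsto_const_nhds ?_ hlt hle
  have h : Tendsto (fun n : ℕ => (1 : ℝ≥0) / (n + 1)) atTop (𝓝 0) :=
    tendsto_one_div_add_atTop_nhds_zero_nat
  simpa using h.const_add t

/-- The discount factor `exp (-x_t)` of a path, as a jointly measurable function. -/
noncomputable def pathWeight (x : ℝ≥0 → ℝ × Fin K) (t : ℝ≥0) : ℝ≥0∞ :=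
  liminf (fun n => ENNReal.ofReal (Real.exp (-(x (rightGrid n t)).1))) atTop

/-- For fixed `n` the grid point depends on `t` only through an integer, so joint measurability
reduces to countably many coordinate maps. -/
theorem measurable_pathWeight :
    Measurable fun p : (ℝ≥0 → ℝ × Fin K) × ℝ≥0 => pathWeight p.1 p.2 := by
  refine Measurable.liminf fun n => ?_
  have h1 : Measurable fun p : (ℝ≥0 → ℝ × Fin K) × ℕ =>
      ENNReal.ofReal (Real.exp (-(p.1 ((p.2 + 1) / (n + 1) : ℝ≥0)).1)) := by
    refine measurable_from_prod_countable_left fun k => ?_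
    have : Measurable fun x : ℝ≥0 → ℝ × Fin K => x ((k + 1) / (n + 1) : ℝ≥0) :=
      measurable_pi_apply _
    exact (Real.measurable_exp.comp (measurable_fst.comp this).neg).ennreal_ofReal
  have h2 : Measurable fun p : (ℝ≥0 → ℝ × Fin K) × ℝ≥0 =>
      (p.1, ⌊(n + 1 : ℝ≥0) * p.2⌋₊) := by
    refine measurable_fst.prodMk (Nat.measurable_floor.comp (measurable_snd.const_mul _))
  exact h1.comp h2

theorem pathWeight_eq {x : ℝ≥0 → ℝ × Fin K} {t : ℝ≥0}
    (h : ContinuousWithinAt (fun s => (x s).1) (Set.Ici t) t) :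
    pathWeight x t = ENNReal.ofReal (Real.exp (-(x t).1)) := by
  refine Tendsto.liminf_eq ?_
  have h1 : Tendsto (fun n => (x (rightGrid n t)).1) atTop (𝓝 (x t).1) :=
    h.tendsto.comp (tendsto_rightGrid t)
  exact (ENNReal.continuous_ofReal.tendsto _).comp ((Real.continuous_exp.tendsto _).comp h1.neg)

/-- The exponential functional of a path. -/
noncomputable def pathFunctional (x : ℝ≥0 → ℝ × Fin K) : ℝ≥0∞ :=
  ∫⁻ t in Set.Ioi (0 : ℝ), pathWeight x t.toNNReal

theorem measurable_pathFunctional : Measurable (pathFunctional (K := K)) := by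
  have h1 : Measurable fun p : (ℝ≥0 → ℝ × Fin K) × ℝ => (p.1, p.2.toNNReal) :=
    measurable_fst.prodMk (measurable_real_toNNReal.comp measurable_snd)
  exact (measurable_pathWeight.comp h1).lintegral_prod_right'

/-- The discount factor `exp (-ξ_s)`, for `s` in the real line. -/
noncomputable def discount (ξ : ℝ≥0 → Ω → ℝ) (s : ℝ) (ω : Ω) : ℝ :=
  Real.exp (-ξ s.toNNReal ω)

/-- The tail `∫_t^∞ e^{-ξ_s} ds` of the exponential functional. -/
noncomputable def tailFunctional (ξ : ℝ≥0 → Ω → ℝ) (t : ℝ) (ω : Ω) : ℝ≥0∞ :=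
  ∫⁻ s in Set.Ioi t, ENNReal.ofReal (discount ξ s ω)

namespace IsMAP

variable {P : ℝ → Fin K → Measure Ω} {ξ : ℝ≥0 → Ω → ℝ} {J : ℝ≥0 → Ω → Fin K}

theorem measurable_mapPath (h : IsMAP P ξ J) : Measurable (mapPath ξ J) :=
  measurable_pi_lambda _ fun s => (h.measurable_pos s).prodMk (h.measurable_type s)

theorem measurable_shiftedPath (h : IsMAP P ξ J) (t : ℝ≥0) : Measurable (shiftedPath ξ J t) :=
  measurable_pi_lambda _ fun _ =>
    ((h.measurable_pos _).sub (h.measurable_pos t)).prodMk (h.measurable_type _)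

theorem measurableSet_type (h : IsMAP P ξ J) (t : ℝ≥0) (j : Fin K) :
    MeasurableSet {ω | J t ω = j} :=
  h.measurable_type t (measurableSet_singleton j)

theorem rightCont_pos (h : IsMAP P ξ J) (ω : Ω) (t : ℝ≥0) :
    ContinuousWithinAt (fun s => ξ s ω) (Set.Ici t) t :=
  continuous_fst.continuousAt.comp_continuousWithinAt (h.right_cont ω t)

/-- Markov property: given `J_t = j`, the shifted path is independent of `ξ_t` and distributed as
the path started at `(0, j)`. -/
theorem map_shiftedPath (h : IsMAP P ξ J) (x : ℝ) (i : Fin K) (t : ℝ≥0) (j : Fin K) :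
    ((P x i).restrict {ω | J t ω = j}).map (fun ω => (ξ t ω, shiftedPath ξ J t ω)) =
      (((P x i).restrict {ω | J t ω = j}).map (ξ t)).prod ((P 0 j).map (mapPath ξ J)) := by
  have := h.prob
  symm
  refine Measure.prod_eq fun B S hB hS => ?_
  rw [Measure.map_apply ((h.measurable_pos t).prodMk (h.measurable_shiftedPath t)) (hB.prod hS),
    Measure.map_apply (h.measurable_pos t) hB, Measure.map_apply h.measurable_mapPath hS,
    Measure.restrict_apply (((h.measurable_pos t).prodMk (h.measurable_shiftedPath t))
      (hB.prod hS)), Measure.restrict_apply (h.measurable_pos t hB)]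
  have hmeas : MeasurableSet[pastSigma ξ J t] (ξ t ⁻¹' B ∩ {ω | J t ω = j}) := by
    have hle : MeasurableSpace.comap (fun ω => (ξ t ω, J t ω)) inferInstance ≤ pastSigma ξ J t :=
      le_iSup (fun u : Set.Iic t => MeasurableSpace.comap (fun ω => (ξ u ω, J u ω)) inferInstance)
        ⟨t, le_refl t⟩
    exact hle _ ⟨B ×ˢ {j}, hB.prod (measurableSet_singleton j), rfl⟩
  have hadd := h.additive x i t _ S hmeas hS
  have hset : (fun ω => (ξ t ω, shiftedPath ξ J t ω)) ⁻¹' B ×ˢ S ∩ {ω | J t ω = j} =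
      (ξ t ⁻¹' B ∩ {ω | J t ω = j}) ∩
        {ω | (fun s => (ξ (t + s) ω - ξ t ω, J (t + s) ω)) ∈ S} := by
    ext ω
    simp only [Set.mem_inter_iff, Set.mem_preimage, Set.mem_prod, Set.mem_ofPred_eq]
    unfold shiftedPath
    tauto
  rw [hset, hadd, setLIntegral_congr_fun (g := fun _ => P 0 j (mapPath ξ J ⁻¹' S))
    ((h.measurable_pos t hB).inter (h.measurableSet_type t j))]
  · rw [setLIntegral_const, mul_comm]
  · rintro ω ⟨-, hω⟩
    simp only [Set.mem_ofPred_eq] at hω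
    simp only [hω]
    rfl

theorem lintegral_eq_sum_type (h : IsMAP P ξ J) (x : ℝ) (i : Fin K) (t : ℝ≥0) (f : Ω → ℝ≥0∞) :
    ∫⁻ ω, f ω ∂(P x i) = ∑ j, ∫⁻ ω in {ω | J t ω = j}, f ω ∂(P x i) := by
  have hU : ⋃ j, {ω | J t ω = j} = Set.univ := by ext ω; simp
  rw [← tsum_fintype (L := .unconditional _), ← lintegral_iUnion (h.measurableSet_type t), hU,
    setLIntegral_univ]
  intro j k hjk
  refine Set.disjoint_left.2 fun ω hj hk => hjk ?_
  exact Eq.trans (Eq.symm hj) hk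

/-- Given `J_t = j`, position and shifted path are independent. This is the factorisation behind
every matrix product in the recursion. -/
theorem lintegral_pos_mul_shiftedPath (h : IsMAP P ξ J) (x : ℝ) (i : Fin K) (t : ℝ≥0)
    {g : ℝ → ℝ≥0∞} (hg : Measurable g) {H : (ℝ≥0 → ℝ × Fin K) → ℝ≥0∞} (hH : Measurable H) :
    ∫⁻ ω, g (ξ t ω) * H (shiftedPath ξ J t ω) ∂(P x i) =
      ∑ j, (∫⁻ ω in {ω | J t ω = j}, g (ξ t ω) ∂(P x i)) *
        ∫⁻ ω, H (mapPath ξ J ω) ∂(P 0 j) := by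
  have := h.prob
  rw [h.lintegral_eq_sum_type x i t]
  refine Finset.sum_congr rfl fun j _ => ?_
  have h1 := lintegral_map (μ := (P x i).restrict {ω | J t ω = j})
    (f := fun p : ℝ × (ℝ≥0 → ℝ × Fin K) => g p.1 * H p.2)
    ((hg.comp measurable_fst).mul (hH.comp measurable_snd))
    ((h.measurable_pos t).prodMk (h.measurable_shiftedPath t))
  rw [← h1, h.map_shiftedPath, lintegral_prod_mul hg.aemeasurable hH.aemeasurable,
    lintegral_map hg (h.measurable_pos t), lintegral_map hH h.measurable_mapPath]

theorem map_shiftedPath_snd (h : IsMAP P ξ J) (x : ℝ) (i : Fin K) (t : ℝ≥0) (j : Fin K) :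
    ((P x i).restrict {ω | J t ω = j}).map (shiftedPath ξ J t) =
      (P x i {ω | J t ω = j}) • ((P 0 j).map (mapPath ξ J)) := by
  have := h.prob
  have h1 := congrArg Measure.snd (h.map_shiftedPath x i t j)
  rw [Measure.snd_map_prodMk (h.measurable_pos t), Measure.snd, Measure.map_snd_prod] at h1
  rw [h1, Measure.map_apply (h.measurable_pos t) MeasurableSet.univ]
  simp

theorem pathWeight_mapPath (h : IsMAP P ξ J) (ω : Ω) (t : ℝ≥0) :
    pathWeight (mapPath ξ J ω) t = ENNReal.ofReal (Real.exp (-ξ t ω)) :=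
  pathWeight_eq (h.rightCont_pos ω t)

theorem pathWeight_shiftedPath (h : IsMAP P ξ J) (ω : Ω) (t s : ℝ≥0) :
    pathWeight (shiftedPath ξ J t ω) s =
      ENNReal.ofReal (Real.exp (ξ t ω)) * ENNReal.ofReal (Real.exp (-ξ (t + s) ω)) := by
  rw [pathWeight_eq, ← ENNReal.ofReal_mul (Real.exp_pos _).le, ← Real.exp_add]
  · simp only [shiftedPath]; ring_nf
  · refine ContinuousWithinAt.sub ?_ continuousWithinAt_const
    exact (h.rightCont_pos ω (t + s)).comp (f := fun u => t + u) (by fun_prop) fun u hu => by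
      simpa using hu

theorem expFunctional_eq (h : IsMAP P ξ J) (ω : Ω) :
    expFunctional ξ ω = pathFunctional (mapPath ξ J ω) := by
  simp only [expFunctional, pathFunctional, h.pathWeight_mapPath]

theorem measurable_expFunctional (h : IsMAP P ξ J) : Measurable (expFunctional ξ) := by
  rw [funext h.expFunctional_eq]
  exact measurable_pathFunctional.comp h.measurable_mapPath

/-- Self-similarity of the functional: translate time by `t` and pull out `e^{-ξ_t}`. -/
theorem tailFunctional_eq (h : IsMAP P ξ J) {t : ℝ} (ht : 0 ≤ t) (ω : Ω) :
    tailFunctional ξ t ω = ENNReal.ofReal (discount ξ t ω) *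
      pathFunctional (shiftedPath ξ J t.toNNReal ω) := by
  unfold pathFunctional tailFunctional discount
  simp_rw [h.pathWeight_shiftedPath]
  rw [lintegral_const_mul', ← mul_assoc, ← ENNReal.ofReal_mul (Real.exp_pos _).le,
    ← Real.exp_add]
  · simp only [neg_add_cancel, Real.exp_zero, ENNReal.ofReal_one, one_mul]
    rw [← (measurePreserving_add_left volume t).setLIntegral_comp_preimage_emb
      (measurableEmbedding_addLeft t)]
    simp only [Set.preimage_const_add_Ioi, sub_self]
    refine setLIntegral_congr_fun measurableSet_Ioi fun s hs => ?_
    simp only [Real.toNNReal_add ht (le_of_lt hs)]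
  · exact ENNReal.ofReal_ne_top

theorem measurable_discount (h : IsMAP P ξ J) :
    Measurable fun p : Ω × ℝ => discount ξ p.2 p.1 := by
  have h0 : Measurable fun p : Ω × ℝ => (mapPath ξ J p.1, p.2.toNNReal) :=
    (h.measurable_mapPath.comp measurable_fst).prodMk
      (measurable_real_toNNReal.comp measurable_snd)
  convert (measurable_pathWeight.comp h0).ennreal_toReal using 2 with p
  rw [Function.comp_apply]
  rw [h.pathWeight_mapPath, ENNReal.toReal_ofReal (Real.exp_pos _).le, discount]

theorem measurable_tailFunctional (h : IsMAP P ξ J) :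
    Measurable fun p : Ω × ℝ => tailFunctional ξ p.2 p.1 := by
  -- The moving domain `(t, ∞)` is encoded as an indicator of `s - t > 0`, so that Tonelli
  -- measurability applies.
  have h1 : Measurable fun p : (Ω × ℝ) × ℝ =>
      (Set.Ioi (0 : ℝ)).indicator (fun _ => ENNReal.ofReal (discount ξ p.2 p.1.1))
        (p.2 - p.1.2) := by
    have h2 : Measurable fun p : (Ω × ℝ) × ℝ => ENNReal.ofReal (discount ξ p.2 p.1.1) :=
      (h.measurable_discount.comp (by fun_prop : Measurable fun p : (Ω × ℝ) × ℝ =>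
        (p.1.1, p.2))).ennreal_ofReal
    have h3 : Measurable fun p : (Ω × ℝ) × ℝ => p.2 - p.1.2 := by fun_prop
    exact h2.ite (h3 measurableSet_Ioi) measurable_const
  convert h1.lintegral_prod_right' (ν := volume) with p
  rw [tailFunctional, ← lintegral_indicator measurableSet_Ioi]
  refine lintegral_congr fun s => ?_
  simp [Set.indicator]

end IsMAP

end

/-! ### Exponential moments of the position -/

section

variable {K : ℕ} {Ω : Type*} [MeasurableSpace Ω]

theorem HasParameters.tendsto_single {P : ℝ → Fin K → Measure Ω} {ξ : ℝ≥0 → Ω → ℝ}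
    {J : ℝ≥0 → Ω → Fin K} {D : MAPData K} (hpar : HasParameters P ξ J D) (hMAP : IsMAP P ξ J)
    {h : ℝ → ℝ} (hh : ContDiff ℝ 1 h) {C : ℝ} (hC : ∀ x, |h x| ≤ C ∧ |deriv h x| ≤ C)
    (i j : Fin K) :
    Tendsto (fun t : ℝ≥0 => ((∫ ω in {ω | J t ω = j}, h (ξ t ω) ∂(P 0 i)) -
      (if i = j then h 0 else 0)) / (t : ℝ)) (𝓝[>] 0)
      (𝓝 (D.generator (fun j' => if j' = j then h else fun _ => 0) 0 i)) := by
  have hC0 : 0 ≤ C := (abs_nonneg _).trans (hC 0).1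
  have h1 := hpar (fun j' => if j' = j then h else fun _ => 0)
    (fun j' => by split_ifs; exacts [hh, contDiff_const])
    ⟨C, fun j' x => by
      split_ifs
      exacts [hC x, by simpa using hC0]⟩ 0 i
  refine h1.congr fun t => ?_
  rw [← integral_indicator (hMAP.measurableSet_type t j)]
  congr 2
  · refine integral_congr_ae (ae_of_all _ fun ω => ?_)
    by_cases hω : J t ω = j <;> simp [hω]
  · split_ifs <;> rfl

namespace IsMAP

variable {P : ℝ → Fin K → Measure Ω} {ξ : ℝ≥0 → Ω → ℝ} {J : ℝ≥0 → Ω → Fin K}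

theorem ae_pos_nonneg (h : IsMAP P ξ J) (i : Fin K) : ∀ᵐ ω ∂(P 0 i), ∀ t, 0 ≤ ξ t ω := by
  filter_upwards [h.start 0 i] with ω hω t
  rw [← hω.1]
  exact h.monotone_pos ω (zero_le (a := t))

theorem integral_eq_sum_type (h : IsMAP P ξ J) (i : Fin K) (t : ℝ≥0) {f : Ω → ℝ}
    (hf : Integrable f (P 0 i)) :
    ∫ ω, f ω ∂(P 0 i) = ∑ j, ∫ ω in {ω | J t ω = j}, f ω ∂(P 0 i) := by
  have hU : ⋃ j, {ω | J t ω = j} = Set.univ := by ext ω; simp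
  rw [← integral_iUnion_fintype (h.measurableSet_type t) _ fun j => hf.integrableOn, hU,
    setIntegral_univ]
  intro j k hjk
  refine Set.disjoint_left.2 fun ω hj hk => hjk ?_
  exact Eq.trans (Eq.symm hj) hk

/-- The increment after `s` is a fresh copy started from type `J_s`; bounds uniform in the type
therefore multiply. -/
theorem lintegral_pos_add_le (h : IsMAP P ξ J) {g : ℝ → ℝ≥0∞} (hg : Measurable g)
    (hsub : ∀ x y, 0 ≤ x → 0 ≤ y → g (x + y) ≤ g x * g y) {s t : ℝ≥0} {A B : ℝ≥0∞}
    (hs : ∀ i, ∫⁻ ω, g (ξ s ω) ∂(P 0 i) ≤ A) (ht : ∀ i, ∫⁻ ω, g (ξ t ω) ∂(P 0 i) ≤ B)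
    (i : Fin K) : ∫⁻ ω, g (ξ (s + t) ω) ∂(P 0 i) ≤ A * B := by
  have hH : Measurable fun x : ℝ≥0 → ℝ × Fin K => g (x t).1 :=
    hg.comp (measurable_fst.comp (measurable_pi_apply t))
  calc ∫⁻ ω, g (ξ (s + t) ω) ∂(P 0 i)
      ≤ ∫⁻ ω, g (ξ s ω) * g (shiftedPath ξ J s ω t).1 ∂(P 0 i) := by
        refine lintegral_mono_ae ?_
        filter_upwards [h.ae_pos_nonneg i] with ω hω
        refine le_trans (le_of_eq ?_) (hsub (ξ s ω) (ξ (s + t) ω - ξ s ω) (hω s)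
          (sub_nonneg.2 (h.monotone_pos ω le_self_add)))
        rw [add_sub_cancel]
    _ = ∑ j, (∫⁻ ω in {ω | J s ω = j}, g (ξ s ω) ∂(P 0 i)) *
        ∫⁻ ω, g (ξ t ω) ∂(P 0 j) := h.lintegral_pos_mul_shiftedPath 0 i s hg hH
    _ ≤ ∑ j, (∫⁻ ω in {ω | J s ω = j}, g (ξ s ω) ∂(P 0 i)) * B := by
        gcongr with j; exact ht j
    _ = (∫⁻ ω, g (ξ s ω) ∂(P 0 i)) * B := by
        rw [← Finset.sum_mul, ← h.lintegral_eq_sum_type]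
    _ ≤ A * B := by gcongr; exact hs i

theorem lintegral_pos_le_pow (h : IsMAP P ξ J) {g : ℝ → ℝ≥0∞} (hg : Measurable g)
    (hsub : ∀ x y, 0 ≤ x → 0 ≤ y → g (x + y) ≤ g x * g y) (hg0 : g 0 ≤ 1) {s : ℝ≥0} {A : ℝ≥0∞}
    (hs : ∀ i, ∫⁻ ω, g (ξ s ω) ∂(P 0 i) ≤ A) (n : ℕ) (i : Fin K) :
    ∫⁻ ω, g (ξ (n * s) ω) ∂(P 0 i) ≤ A ^ n := by
  induction n generalizing i with
  | zero =>
    have := h.prob 0 i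
    calc ∫⁻ ω, g (ξ ((0 : ℕ) * s) ω) ∂(P 0 i) ≤ ∫⁻ _, 1 ∂(P 0 i) := by
          refine lintegral_mono_ae ?_
          filter_upwards [h.start 0 i] with ω hω
          simpa [hω.1] using hg0
      _ = A ^ 0 := by simp
  | succ n ih =>
    have := h.lintegral_pos_add_le hg hsub ih hs i
    rw [pow_succ]
    convert this using 5
    push_cast; ring

/-- Exponential moments of the parameters give exponential moments of the position. -/
theorem lintegral_exp_le (h : IsMAP P ξ J) {D : MAPData K} (hpar : HasParameters P ξ J D)
    {q Q : ℝ} (hq : 0 ≤ q) (hqQ : q < Q) (hQ : D.ExpMoment Q) :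
    ∃ C, 0 ≤ C ∧ ∀ (t : ℝ≥0) (i : Fin K),
      ∫⁻ ω, ENNReal.ofReal (Real.exp (q * ξ t ω)) ∂(P 0 i) ≤ ENNReal.ofReal (Real.exp (C * t)) := by
  have hprob := h.prob
  -- `C` strictly exceeds every row sum of `-Φ(-q)`; strictness lets the bound survive replacing
  -- `e^{qx}` by its truncation for small `a`.
  set C : ℝ := ∑ i, |∑ j, -D.bernstein (-q) i j| + 1 with hCdef
  have hC0 : 0 ≤ C := by positivity
  have hlt : ∀ i, ∑ j, -D.bernstein (-q) i j < C := fun i => by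
    have : |∑ j, -D.bernstein (-q) i j| ≤ ∑ i, |∑ j, -D.bernstein (-q) i j| :=
      Finset.single_le_sum (f := fun i => |∑ j, -D.bernstein (-q) i j|)
        (fun _ _ => abs_nonneg _) (Finset.mem_univ i)
    have := le_abs_self (∑ j, -D.bernstein (-q) i j)
    linarith
  refine ⟨C, hC0, fun t i => ?_⟩
  have hev : ∀ᶠ a in 𝓝[>] (0 : ℝ), ∀ i, ∑ j,
      D.generator (fun j' => if j' = j then truncExp a q else fun _ => 0) 0 i < C :=
    eventually_all.2 fun i => (tendsto_finsetSum _ fun j _ =>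
      hQ.tendsto_generator_truncExp hq hqQ i j).eventually_lt_const (hlt i)
  have hbound : ∀ᶠ a in 𝓝[>] (0 : ℝ),
      ∫⁻ ω, ENNReal.ofReal (truncExp a q (ξ t ω)) ∂(P 0 i) ≤ ENNReal.ofReal (Real.exp (C * t)) := by
    filter_upwards [hev, self_mem_nhdsWithin] with a ha ha0
    replace ha0 : 0 < a := ha0
    have hint : ∀ s i, Integrable (fun ω => truncExp a q (ξ s ω)) (P 0 i) := fun s i =>
      Integrable.of_bound (C := Real.exp (q / a))
        (truncExp.measurable.comp (h.measurable_pos s)).aestronglyMeasurable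
        (ae_of_all _ fun ω => by
          rw [Real.norm_eq_abs, abs_of_pos (truncExp.pos _)]; exact truncExp.le_bound ha0 hq _)
    -- A derivative at time `0` below `C` gives an expectation at most `1 + Cs ≤ e^{Cs}` for small
    -- `s`.
    have hsmall : ∀ᶠ s : ℝ≥0 in 𝓝[>] 0, ∀ i,
        ∫⁻ ω, ENNReal.ofReal (truncExp a q (ξ s ω)) ∂(P 0 i) ≤
          ENNReal.ofReal (Real.exp (C * s)) := by
      refine eventually_all.2 fun i => ?_
      have h1 := tendsto_finsetSum Finset.univ fun j (_ : j ∈ Finset.univ) =>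
        hpar.tendsto_single h (truncExp.contDiff (a := a) (q := q))
          (C := max (Real.exp (q / a)) (a * Real.exp (q / a)))
          (fun x => ⟨by
            rw [abs_of_pos (truncExp.pos x)]
            exact (truncExp.le_bound ha0 hq x).trans (le_max_left _ _),
            (truncExp.abs_deriv_le ha0 hq x).trans (le_max_right _ _)⟩) i j
      filter_upwards [h1.eventually_lt_const (ha i), self_mem_nhdsWithin] with s hs hs0
      replace hs0 : (0 : ℝ) < s := NNReal.coe_pos.2 hs0
      rw [← Finset.sum_div, Finset.sum_sub_distrib, ← h.integral_eq_sum_type i s (hint s i),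
        div_lt_iff₀ hs0] at hs
      simp only [truncExp.apply_zero, Finset.sum_ite_eq, Finset.mem_univ, if_true] at hs
      rw [← ofReal_integral_eq_lintegral_ofReal (hint s i) (ae_of_all _ fun ω =>
        (truncExp.pos _).le)]
      refine ENNReal.ofReal_le_ofReal ?_
      linarith [Real.add_one_le_exp (C * s)]
    have hdiv : Tendsto (fun n : ℕ => t / ((n : ℝ≥0) + 1)) atTop (𝓝 0) := by
      have := (tendsto_one_div_add_atTop_nhds_zero_nat (𝕜 := ℝ≥0)).const_mul t
      simpa [div_eq_mul_inv] using this
    rcases eq_or_ne t 0 with rfl | ht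
    -- The zeroth power of the trivial bound `⊤` is `1`.
    · have : ∫⁻ ω, ENNReal.ofReal (truncExp a q (ξ 0 ω)) ∂(P 0 i) ≤ 1 := by
        simpa using h.lintegral_pos_le_pow (g := fun x => ENNReal.ofReal (truncExp a q x)) (s := 0)
          (A := ⊤) truncExp.measurable.ennreal_ofReal
          (fun x y hx hy => by
            rw [← ENNReal.ofReal_mul (truncExp.pos _).le]
            exact ENNReal.ofReal_le_ofReal (truncExp.add_le_mul ha0 hq hx hy))
          (by simp) (fun _ => le_top) 0 i
      simpa using this
    have hdiv' : Tendsto (fun n : ℕ => t / ((n : ℝ≥0) + 1)) atTop (𝓝[>] 0) :=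
      tendsto_nhdsWithin_iff.2 ⟨hdiv, Eventually.of_forall fun n => by
        have := pos_iff_ne_zero.2 ht
        simp only [Set.mem_Ioi]; positivity⟩
    -- Submultiplicativity propagates the bound from the short time `t/(n+1)` to `t`, with the same
    -- `C` for all small `a`; Fatou then removes the truncation.
    obtain ⟨n, hn⟩ := (hdiv'.eventually hsmall).exists
    have h2 := h.lintegral_pos_le_pow (g := fun x => ENNReal.ofReal (truncExp a q x))
      truncExp.measurable.ennreal_ofReal
      (fun x y hx hy => by
        rw [← ENNReal.ofReal_mul (truncExp.pos _).le]
        exact ENNReal.ofReal_le_ofReal (truncExp.add_le_mul ha0 hq hx hy))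
      (by simp) hn (n + 1) i
    rw [← ENNReal.ofReal_pow (Real.exp_pos _).le, ← Real.exp_nat_mul] at h2
    have h3 : ((n + 1 : ℕ) : ℝ≥0) * (t / ((n : ℝ≥0) + 1)) = t := by
      push_cast; field_simp
    rw [h3] at h2
    convert h2 using 3
    push_cast; field_simp
  calc ∫⁻ ω, ENNReal.ofReal (Real.exp (q * ξ t ω)) ∂(P 0 i)
      = ∫⁻ ω, liminf (fun a => ENNReal.ofReal (truncExp a q (ξ t ω))) (𝓝[>] 0) ∂(P 0 i) := by
        refine lintegral_congr_ae ?_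
        filter_upwards [h.ae_pos_nonneg i] with ω hω
        exact ((ENNReal.continuous_ofReal.tendsto _).comp
          (truncExp.tendsto hq (hω t))).liminf_eq.symm
    _ ≤ liminf (fun a => ∫⁻ ω, ENNReal.ofReal (truncExp a q (ξ t ω)) ∂(P 0 i)) (𝓝[>] 0) :=
        lintegral_liminf_le fun a =>
          (truncExp.measurable.comp (h.measurable_pos t)).ennreal_ofReal
    _ ≤ ENNReal.ofReal (Real.exp (C * t)) :=
        liminf_le_of_frequently_le' hbound.frequently

end IsMAP

end

/-! ### Derivatives at time zero -/

theorem abs_sub_exp_sub_one_div_le {q x : ℝ} (hq : 0 < q) (hx : 0 ≤ x) :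
    |(Real.exp (q * x) - 1) / q - x| ≤ q * (x ^ 2 * Real.exp (q * x)) := by
  have h1 : q * x + 1 ≤ Real.exp (q * x) := Real.add_one_le_exp _
  have h2 : Real.exp (q * x) * (1 - q * x) ≤ 1 := by
    have h3 : 1 - q * x ≤ Real.exp (-(q * x)) := by linarith [Real.add_one_le_exp (-(q * x))]
    calc Real.exp (q * x) * (1 - q * x) ≤ Real.exp (q * x) * Real.exp (-(q * x)) := by gcongr
      _ = 1 := by rw [← Real.exp_add]; simp
  have h4 : (Real.exp (q * x) - 1) / q - x = (Real.exp (q * x) - 1 - q * x) / q := by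
    field_simp
  rw [h4, abs_of_nonneg (div_nonneg (by linarith) hq.le), div_le_iff₀ hq]
  have h5 : 0 ≤ q * x := by positivity
  nlinarith

section

variable {K : ℕ} {Ω : Type*} [MeasurableSpace Ω]

namespace IsMAP

variable {P : ℝ → Fin K → Measure Ω} {ξ : ℝ≥0 → Ω → ℝ} {J : ℝ≥0 → Ω → Fin K} {D : MAPData K}

theorem integrable_exp (h : IsMAP P ξ J) (hpar : HasParameters P ξ J D) {q Q : ℝ} (hq : 0 ≤ q)
    (hqQ : q < Q) (hQ : D.ExpMoment Q) (t : ℝ≥0) (i : Fin K) :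
    Integrable (fun ω => Real.exp (q * ξ t ω)) (P 0 i) := by
  obtain ⟨C, -, hC⟩ := h.lintegral_exp_le hpar hq hqQ hQ
  refine ⟨(Real.measurable_exp.comp ((h.measurable_pos t).const_mul q)).aestronglyMeasurable, ?_⟩
  rw [hasFiniteIntegral_iff_ofReal (ae_of_all _ fun _ => (Real.exp_pos _).le)]
  exact (hC t i).trans_lt ENNReal.ofReal_lt_top

theorem integrable_pos (h : IsMAP P ξ J) (hpar : HasParameters P ξ J D) {Q : ℝ}
    (hQ0 : 0 < Q) (hQ : D.ExpMoment Q) (t : ℝ≥0) (i : Fin K) : Integrable (ξ t) (P 0 i) := by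
  refine ((h.integrable_exp hpar (half_pos hQ0).le (half_lt_self hQ0) hQ t i).const_mul
    (Q / 2)⁻¹).mono' (h.measurable_pos t).aestronglyMeasurable ?_
  filter_upwards [h.ae_pos_nonneg i] with ω hω
  rw [Real.norm_eq_abs, abs_of_nonneg (hω t), inv_mul_eq_div, le_div_iff₀ (half_pos hQ0)]
  linarith [Real.add_one_le_exp (Q / 2 * ξ t ω)]

/-- Difference quotients at time `0` pass to the limit along approximations controlled by an
exponential. -/
theorem tendsto_div_of_approx (h : IsMAP P ξ J) (hpar : HasParameters P ξ J D) {R Q : ℝ}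
    (hR : 0 < R) (hRQ : R < Q) (hQ : D.ExpMoment Q) (i j : Fin K) {p : Filter ℝ} [p.NeBot]
    {F : ℝ → ℝ → ℝ} {f : ℝ → ℝ} (hf : Measurable f) {ε : ℝ → ℝ} (hε : Tendsto ε p (𝓝 0))
    (hb : ∀ᶠ a in p, ∀ x, 0 ≤ x → |F a x - f x| ≤ ε a * (Real.exp (R * x) - 1))
    (hint : ∀ᶠ a in p, ∀ t, Integrable (fun ω => F a (ξ t ω)) (P 0 i)) {L : ℝ → ℝ} {ℓ : ℝ}
    (hL : ∀ᶠ a in p, Tendsto (fun t : ℝ≥0 => ((∫ ω in {ω | J t ω = j}, F a (ξ t ω) ∂(P 0 i)) -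
      (if i = j then F a 0 else 0)) / (t : ℝ)) (𝓝[>] 0) (𝓝 (L a)))
    (hℓ : Tendsto L p (𝓝 ℓ)) :
    Tendsto (fun t : ℝ≥0 => ((∫ ω in {ω | J t ω = j}, f (ξ t ω) ∂(P 0 i)) -
      (if i = j then f 0 else 0)) / (t : ℝ)) (𝓝[>] 0) (𝓝 ℓ) := by
  have hprob := h.prob
  obtain ⟨C, hC0, hC⟩ := h.lintegral_exp_le hpar hR.le hRQ hQ
  have hexp : ∀ t, Integrable (fun ω => Real.exp (R * ξ t ω)) (P 0 i) := fun t =>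
    h.integrable_exp hpar hR.le hRQ hQ t i
  have hle : ∀ t : ℝ≥0, ∫ ω, Real.exp (R * ξ t ω) ∂(P 0 i) ≤ Real.exp (C * t) := fun t => by
    have := hC t i
    rw [← ofReal_integral_eq_lintegral_ofReal (hexp t) (ae_of_all _ fun ω => (Real.exp_pos _).le)]
      at this
    exact (ENNReal.ofReal_le_ofReal_iff (Real.exp_pos _).le).1 this
  -- Exchanging the limits needs uniformity in `t`: for `0 < t ≤ 1` the quotients differ by at most
  -- `ε(a)(e^{Ct} - 1)/t ≤ ε(a) C e^C`.
  refine TendstoUniformlyOnFilter.tendsto_of_eventually_tendsto (p := p) (L := L)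
    (F := fun a (t : ℝ≥0) => ((∫ ω in {ω | J t ω = j}, F a (ξ t ω) ∂(P 0 i)) -
      (if i = j then F a 0 else 0)) / (t : ℝ)) ?_ hL hℓ
  rw [Metric.tendstoUniformlyOnFilter_iff]
  intro η hη
  have h1 : ∀ᶠ a in p, ε a * (C * Real.exp C) < η := by
    have := hε.mul_const (C * Real.exp C)
    rw [zero_mul] at this
    exact this.eventually_lt_const hη
  have h2 : ∀ᶠ t : ℝ≥0 in 𝓝[>] 0, 0 < t ∧ t ≤ 1 := by
    filter_upwards [self_mem_nhdsWithin,
      mem_nhdsWithin_of_mem_nhds (Iic_mem_nhds (zero_lt_one (α := ℝ≥0)))] with t ht ht1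
    exact ⟨ht, ht1⟩
  filter_upwards [((h1.and hb).and hint).prod_mk h2] with ⟨a, t⟩ ⟨⟨⟨ha1, hab⟩, hai⟩, ht0, ht1⟩
  simp only at ha1 hab hai ht0 ht1 ⊢
  -- The sign of `ε` is forced by the bound at `x = 1`, where `e^R - 1 > 0`.
  have hε0 : 0 ≤ ε a := by
    have hR1 := hab 1 zero_le_one
    have : 1 < Real.exp (R * 1) := Real.one_lt_exp_iff.2 (by linarith)
    by_contra hcon
    nlinarith [abs_nonneg (F a 1 - f 1)]
  have hle' : |∫ ω in {ω | J t ω = j}, F a (ξ t ω) ∂(P 0 i) -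
      ∫ ω in {ω | J t ω = j}, f (ξ t ω) ∂(P 0 i)| ≤ ε a * (Real.exp (C * t) - 1) := by
    have hdiff : ∀ᵐ ω ∂(P 0 i), ‖F a (ξ t ω) - f (ξ t ω)‖ ≤
        ε a * (Real.exp (R * ξ t ω) - 1) := by
      filter_upwards [h.ae_pos_nonneg i] with ω hω using hab _ (hω t)
    have hbi : Integrable (fun ω => ε a * (Real.exp (R * ξ t ω) - 1)) (P 0 i) :=
      ((hexp t).sub (integrable_const 1)).const_mul _
    have hfm : AEStronglyMeasurable (fun ω => f (ξ t ω)) (P 0 i) :=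
      (hf.comp (h.measurable_pos t)).aestronglyMeasurable
    have hdi : Integrable (fun ω => F a (ξ t ω) - f (ξ t ω)) (P 0 i) :=
      hbi.mono' ((hai t).aestronglyMeasurable.sub hfm) hdiff
    have hfi : Integrable (fun ω => f (ξ t ω)) (P 0 i) := by
      have := (hai t).sub hdi
      refine this.congr (ae_of_all _ fun ω => ?_)
      simp
    rw [← integral_sub (hai t).integrableOn hfi.integrableOn]
    calc |∫ ω in {ω | J t ω = j}, (F a (ξ t ω) - f (ξ t ω)) ∂(P 0 i)|
        ≤ ∫ ω in {ω | J t ω = j}, ‖F a (ξ t ω) - f (ξ t ω)‖ ∂(P 0 i) :=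
          norm_integral_le_integral_norm (fun ω => F a (ξ t ω) - f (ξ t ω))
      _ ≤ ∫ ω, ‖F a (ξ t ω) - f (ξ t ω)‖ ∂(P 0 i) :=
          setIntegral_le_integral hdi.norm (ae_of_all _ fun ω => norm_nonneg _)
      _ ≤ ∫ ω, ε a * (Real.exp (R * ξ t ω) - 1) ∂(P 0 i) := integral_mono_ae hdi.norm hbi hdiff
      _ = ε a * (∫ ω, Real.exp (R * ξ t ω) ∂(P 0 i) - 1) := by
          rw [integral_const_mul, integral_sub (hexp t) (integrable_const 1)]; simp
      _ ≤ ε a * (Real.exp (C * t) - 1) := by gcongr; exact hle t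
  have hF0 : F a 0 = f 0 := by
    have := hab 0 le_rfl
    simpa [sub_eq_zero] using this
  have ht : (0 : ℝ) < t := NNReal.coe_pos.2 ht0
  rw [dist_comm, Real.dist_eq, hF0, ← sub_div, sub_sub_sub_cancel_right, abs_div,
    abs_of_pos ht, div_lt_iff₀ ht]
  refine hle'.trans_lt ?_
  have h5 : Real.exp (C * t) - 1 ≤ C * t * Real.exp (C * t) := by
    have h3 : 1 - C * t ≤ Real.exp (-(C * t)) := by linarith [Real.add_one_le_exp (-(C * t))]
    have : Real.exp (C * t) * (1 - C * t) ≤ 1 := by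
      calc Real.exp (C * t) * (1 - C * t) ≤ Real.exp (C * t) * Real.exp (-(C * t)) := by gcongr
        _ = 1 := by rw [← Real.exp_add]; simp
    linarith
  have ht1' : (t : ℝ) ≤ 1 := by exact_mod_cast ht1
  have h6 : Real.exp (C * t) ≤ Real.exp C := by
    apply Real.exp_le_exp.2; nlinarith
  have h7 : Real.exp (C * t) - 1 ≤ C * Real.exp C * t := by
    refine h5.trans ?_
    have : C * t * Real.exp (C * t) ≤ C * t * Real.exp C := by gcongr
    linarith
  calc ε a * (Real.exp (C * t) - 1) ≤ ε a * (C * Real.exp C * t) := by gcongr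
    _ = ε a * (C * Real.exp C) * t := by ring
    _ < η * t := by gcongr

/-- `Φ` as the derivative at time `0` of the exponential moments on the events `J_t = j`. -/
theorem tendsto_exp_type (h : IsMAP P ξ J) (hpar : HasParameters P ξ J D) {q Q : ℝ}
    (hq : 0 ≤ q) (hqQ : q < Q) (hQ : D.ExpMoment Q) (i j : Fin K) :
    Tendsto (fun t : ℝ≥0 => ((∫ ω in {ω | J t ω = j}, Real.exp (q * ξ t ω) ∂(P 0 i)) -
      (if i = j then 1 else 0)) / (t : ℝ)) (𝓝[>] 0) (𝓝 (-D.bernstein (-q) i j)) := by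
  have hprob := h.prob
  -- Two margins `δ` absorb the factor `x²` of the truncation error, and a strict gap below `Q`
  -- remains.
  obtain ⟨δ, hδ, hδQ⟩ : ∃ δ, 0 < δ ∧ q + δ + δ < Q := ⟨(Q - q) / 4, by linarith, by linarith⟩
  have key := h.tendsto_div_of_approx hpar (R := q + δ + δ) (by linarith) hδQ hQ i j
    (p := 𝓝[>] (0 : ℝ)) (F := fun a x => truncExp a q x) (f := fun x => Real.exp (q * x))
    (ε := fun a => q * a / δ ^ 2)
    (L := fun a => D.generator (fun j' => if j' = j then truncExp a q else fun _ => 0) 0 i)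
    (by fun_prop)
    ((Continuous.tendsto' (by fun_prop) 0 _ (by simp)).mono_left nhdsWithin_le_nhds)
    (by
      filter_upwards [self_mem_nhdsWithin] with a ha x hx
      replace ha : 0 < a := ha
      rw [abs_sub_comm, abs_of_nonneg (by linarith [truncExp.le_exp ha hq x])]
      refine (truncExp.exp_sub_le ha hq hx).trans ?_
      calc q * a * (x ^ 2 * Real.exp (q * x))
          ≤ q * a * ((Real.exp ((q + δ + δ) * x) - 1) / δ ^ 2) := by
            gcongr; exact sq_mul_exp_le_exp_sub_one_div hq hδ hx
        _ = _ := by ring)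
    (by
      filter_upwards [self_mem_nhdsWithin] with a ha t
      exact Integrable.of_bound (C := Real.exp (q / a))
        (truncExp.measurable.comp (h.measurable_pos t)).aestronglyMeasurable
        (ae_of_all _ fun ω => by
          rw [Real.norm_eq_abs, abs_of_pos (truncExp.pos _)]; exact truncExp.le_bound ha hq _))
    (by
      filter_upwards [self_mem_nhdsWithin] with a ha
      exact hpar.tendsto_single h truncExp.contDiff
          (C := max (Real.exp (q / a)) (a * Real.exp (q / a)))
          (fun x => ⟨by
            rw [abs_of_pos (truncExp.pos x)]
            exact (truncExp.le_bound ha hq x).trans (le_max_left _ _),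
            (truncExp.abs_deriv_le ha hq x).trans (le_max_right _ _)⟩) i j)
    (hQ.tendsto_generator_truncExp hq hqQ i j)
  simpa using key

/-- The identity is approximated by `(e^{qx} - 1)/q`, whose derivative at time `0` is `(Φ(0) -
Φ(-q))/q`; this tends to `Φ'(0)` as `q → 0`. -/
theorem tendsto_pos_type (h : IsMAP P ξ J) (hpar : HasParameters P ξ J D) {Q : ℝ}
    (hQ0 : 0 < Q) (hQ : D.ExpMoment Q) (i j : Fin K) :
    Tendsto (fun t : ℝ≥0 => (∫ ω in {ω | J t ω = j}, ξ t ω ∂(P 0 i)) / (t : ℝ)) (𝓝[>] 0)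
      (𝓝 (D.bernsteinDeriv i j)) := by
  have hprob := h.prob
  have hδ : 0 < Q / 4 := by positivity
  have hsmall : ∀ᶠ q in 𝓝[>] (0 : ℝ), 0 < q ∧ q ≤ Q / 4 := by
    filter_upwards [self_mem_nhdsWithin, mem_nhdsWithin_of_mem_nhds (Iic_mem_nhds hδ)] with q h1 h2
    exact ⟨h1, h2⟩
  have key := h.tendsto_div_of_approx hpar (R := Q / 4 + Q / 4 + Q / 4) (by linarith)
    (by linarith) hQ i j
    (p := 𝓝[>] (0 : ℝ)) (F := fun q x => (Real.exp (q * x) - 1) / q) (f := fun x => x)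
    (ε := fun q => q / (Q / 4) ^ 2)
    (L := fun q => (D.bernstein 0 i j - D.bernstein (-q) i j) / q)
    measurable_id
    ((Continuous.tendsto' (by fun_prop) 0 _ (by simp)).mono_left nhdsWithin_le_nhds)
    (by
      filter_upwards [hsmall] with q hq x hx
      refine (abs_sub_exp_sub_one_div_le hq.1 hx).trans ?_
      have h1 : q ≤ Q / 4 := hq.2
      have h2 := hq.1
      calc q * (x ^ 2 * Real.exp (q * x))
          ≤ q * (x ^ 2 * Real.exp (Q / 4 * x)) := by gcongr
        _ ≤ q * ((Real.exp ((Q / 4 + Q / 4 + Q / 4) * x) - 1) / (Q / 4) ^ 2) := by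
            gcongr; exact sq_mul_exp_le_exp_sub_one_div hδ.le hδ hx
        _ = _ := by ring)
    (by
      filter_upwards [hsmall] with q hq t
      exact ((h.integrable_exp hpar hq.1.le (by linarith [hq.2]) hQ t i).sub
        (integrable_const 1)).div_const q)
    (by
      filter_upwards [hsmall] with q hq
      have h1 := h.tendsto_exp_type hpar hq.1.le (by linarith [hq.2]) hQ i j
      have h2 := h.tendsto_exp_type hpar le_rfl hQ0 hQ i j
      have h3 := (h1.sub h2).div_const q
      rw [neg_zero, neg_sub_neg] at h3
      refine h3.congr fun t => ?_
      have h4 := (h.integrable_exp hpar hq.1.le (by linarith [hq.2]) hQ t i).integrableOn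
        (s := {ω | J t ω = j})
      rw [integral_div, integral_sub h4 (integrable_const 1)]
      simp only [zero_mul, mul_zero, Real.exp_zero, sub_self, zero_div, ite_self, sub_zero]
      rw [← sub_div, sub_sub_sub_cancel_right, div_right_comm])
    (by
      have h1 := (hQ.hasDerivAt_bernstein hQ0 i j).tendsto_slope_zero
      have h2 : Tendsto (fun q : ℝ => -q) (𝓝[>] 0) (𝓝[≠] 0) := by
        refine tendsto_nhdsWithin_iff.2 ⟨(Continuous.tendsto' (by fun_prop) 0 _ (by simp)).mono_left
          nhdsWithin_le_nhds, ?_⟩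
        filter_upwards [self_mem_nhdsWithin] with q hq
        simpa using (ne_of_gt hq)
      refine (h1.comp h2).congr fun q => ?_
      simp only [Function.comp_apply, zero_add, smul_eq_mul, inv_neg]
      ring)
  simpa using key

end IsMAP

end

/-! ### Finiteness of the exponential functional -/

section

variable {K : ℕ} {Ω : Type*} [MeasurableSpace Ω]

namespace MAPData

theorem arctan_le_two_mul_min {x : ℝ} (hx : 0 < x) : Real.arctan x ≤ 2 * min 1 x := by
  rcases le_total x 1 with h | h
  · rw [min_eq_right h]
    have := Real.lt_tan (Real.arctan_pos.2 hx) (Real.arctan_lt_pi_div_two x)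
    rw [Real.tan_arctan] at this
    linarith
  · rw [min_eq_left h]
    linarith [Real.arctan_lt_pi_div_two x, Real.pi_lt_four]

theorem integrable_arctan_levy (D : MAPData K) (i : Fin K) :
    Integrable Real.arctan (D.levy i) := by
  have h1 : Integrable (fun x : ℝ => min 1 x) (D.levy i) := by
    refine ⟨by fun_prop, ?_⟩
    rw [hasFiniteIntegral_iff_ofReal]
    · exact D.levy_integrable i
    · filter_upwards [D.ae_levy_pos i] with x hx
      exact le_min zero_le_one hx.le
  refine (h1.const_mul 2).mono' (Real.measurable_arctan.aestronglyMeasurable) ?_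
  filter_upwards [D.ae_levy_pos i] with x hx
  rw [Real.norm_eq_abs, abs_of_nonneg (Real.arctan_nonneg.2 hx.le)]
  exact arctan_le_two_mul_min hx

theorem integrable_arctan_jump (D : MAPData K) (i j : Fin K) :
    Integrable Real.arctan (D.jump i j) := by
  have := D.jump_prob i j
  refine Integrable.of_bound (C := Real.pi / 2) Real.measurable_arctan.aestronglyMeasurable
    (ae_of_all _ fun x => ?_)
  rw [Real.norm_eq_abs, abs_le]
  exact ⟨(Real.neg_pi_div_two_lt_arctan x).le, (Real.arctan_lt_pi_div_two x).le⟩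

/-- `arctan` is bounded, vanishes at `0` and is positive on `(0, ∞)`. The generator at `0` is then a
sum of nonnegative terms, each of which must vanish. -/
theorem not_nonConstant_of_generator_arctan (D : MAPData K)
    (h : ∀ i, D.generator (fun _ => Real.arctan) 0 i = 0) : ¬ D.NonConstant := by
  have hlevy : ∀ i, 0 ≤ ∫ y, Real.arctan y ∂(D.levy i) := fun i =>
    integral_nonneg_of_ae ((D.ae_levy_pos i).mono fun y hy => Real.arctan_nonneg.2 hy.le)
  have hjump : ∀ i j, 0 ≤ ∫ y, Real.arctan y ∂(D.jump i j) := fun i j =>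
    integral_nonneg_of_ae ((D.ae_jump_nonneg i j).mono fun y hy => Real.arctan_nonneg.2 hy)
  have hterm : ∀ i j, 0 ≤ D.rate i j * ∫ y, Real.arctan y ∂(D.jump i j) := fun i j => by
    by_cases hij : i = j
    · subst hij; simp [D.jump_diag]
    · exact mul_nonneg (D.rate_nonneg i j hij) (hjump i j)
  have hsum : ∀ i, D.drift i + ∫ y, Real.arctan y ∂(D.levy i) +
      ∑ j, D.rate i j * ∫ y, Real.arctan y ∂(D.jump i j) = 0 := fun i => by
    have := h i
    simpa [generator] using this
  have hzero : ∀ i, D.drift i = 0 ∧ ∫ y, Real.arctan y ∂(D.levy i) = 0 ∧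
      ∀ j, D.rate i j * ∫ y, Real.arctan y ∂(D.jump i j) = 0 := fun i => by
    have h1 := hsum i
    have h2 := Finset.sum_nonneg fun j (_ : j ∈ Finset.univ) => hterm i j
    have h3 := D.drift_nonneg i
    have h4 := hlevy i
    refine ⟨by linarith, by linarith, fun j => ?_⟩
    exact (Finset.sum_eq_zero_iff_of_nonneg fun j _ => hterm i j).1 (by linarith) j
      (Finset.mem_univ j)
  rintro (⟨i, hi | hi⟩ | ⟨i, j, -, hr, hB⟩)
  · exact hi.ne' (hzero i).1
  · have h1 := (integral_eq_zero_iff_of_nonneg_ae ((D.ae_levy_pos i).mono fun y hy =>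
      Real.arctan_nonneg.2 hy.le) (D.integrable_arctan_levy i)).1 (hzero i).2.1
    refine hi (ae_eq_bot.1 (eventually_false_iff_eq_bot.1 ?_))
    filter_upwards [h1, D.ae_levy_pos i] with y hy hy0
    exact (Real.arctan_pos.2 hy0).ne' hy
  · have h0 := (mul_eq_zero.1 ((hzero i).2.2 j)).resolve_left hr.ne'
    have h1 := (integral_eq_zero_iff_of_nonneg_ae ((D.ae_jump_nonneg i j).mono fun y hy =>
      Real.arctan_nonneg.2 hy) (D.integrable_arctan_jump i j)).1 h0
    refine hB.ne' (measure_mono_null (fun y hy => ?_) (ae_iff.1 h1))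
    exact (Real.arctan_pos.2 hy).ne'

end MAPData

namespace IsMAP

variable {P : ℝ → Fin K → Measure Ω} {ξ : ℝ≥0 → Ω → ℝ} {J : ℝ≥0 → Ω → Fin K} {D : MAPData K}

/-- Testing the generator on the indicator of type `j` gives `P_i(J_t = j)/t → λ_{ij}`. -/
theorem exists_type_pos (h : IsMAP P ξ J) (hpar : HasParameters P ξ J D) {i j : Fin K}
    (hij : i ≠ j) (hr : 0 < D.rate i j) : ∃ t, 0 < P 0 i {ω | J t ω = j} := by
  have := h.prob 0 i
  have := D.jump_prob i j
  have h1 := hpar.tendsto_single h (contDiff_const (c := (1 : ℝ))) (C := 1) (by simp) i j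
  rw [MAPData.generator_single] at h1
  simp only [hij, if_false, zero_add, sub_zero, integral_const, probReal_univ, smul_eq_mul,
    mul_one] at h1
  obtain ⟨t, ht⟩ := (h1.eventually_const_lt hr).exists
  refine ⟨t, pos_iff_ne_zero.2 fun h0 => ?_⟩
  simp [Measure.real, h0] at ht

/-- If the position stays at `0` from `i`, it also does so after reaching `j` at a fixed time; the
Markov property transfers this to the start from `j`. Irreducibility then spreads it to all types.
-/
theorem measure_pos_eq_zero_of_rate_pos (h : IsMAP P ξ J) (hpar : HasParameters P ξ J D)
    {i j : Fin K} (hi : ∀ t, P 0 i {ω | 0 < ξ t ω} = 0) (hr : 0 < D.rate i j) (s : ℝ≥0) :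
    P 0 j {ω | 0 < ξ s ω} = 0 := by
  rcases eq_or_ne i j with rfl | hij
  · exact hi s
  obtain ⟨t, ht⟩ := h.exists_type_pos hpar hij hr
  have hS : MeasurableSet {x : ℝ≥0 → ℝ × Fin K | 0 < (x s).1} :=
    (measurable_fst.comp (measurable_pi_apply s)) measurableSet_Ioi
  have h1 := congrArg (fun μ => μ {x : ℝ≥0 → ℝ × Fin K | 0 < (x s).1})
    (h.map_shiftedPath_snd 0 i t j)
  simp only [Measure.smul_apply, smul_eq_mul] at h1
  rw [Measure.map_apply (h.measurable_shiftedPath t) hS,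
    Measure.map_apply h.measurable_mapPath hS] at h1
  have h2 : ((P 0 i).restrict {ω | J t ω = j})
      (shiftedPath ξ J t ⁻¹' {x : ℝ≥0 → ℝ × Fin K | 0 < (x s).1}) = 0 := by
    refine measure_mono_null (t := {ω | ¬ (0 ≤ ξ t ω)} ∪ {ω | 0 < ξ (t + s) ω}) ?_ ?_
    · intro ω hω
      have hω' : 0 < ξ (t + s) ω - ξ t ω := hω
      by_cases h0 : 0 ≤ ξ t ω
      · right
        change 0 < ξ (t + s) ω
        linarith
      · exact Or.inl h0
    · refine measure_union_null ?_ ?_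
      · refine Measure.absolutelyContinuous_of_le Measure.restrict_le_self ?_
        exact ae_iff.1 ((h.ae_pos_nonneg i).mono fun ω hω => hω t)
      · exact Measure.absolutelyContinuous_of_le Measure.restrict_le_self (hi (t + s))
  rw [h2] at h1
  exact (mul_eq_zero.1 h1.symm).resolve_left ht.ne'

/-- The position leaves `0` with positive probability, uniformly over the starting types. -/
theorem exists_measure_pos (h : IsMAP P ξ J) (hpar : HasParameters P ξ J D)
    (hirr : D.Irreducible) (hnc : D.NonConstant) :
    ∃ T : ℝ≥0, 0 < T ∧ ∀ i, 0 < P 0 i {ω | 0 < ξ T ω} := by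
  have hex : ∀ i, ∃ t, 0 < P 0 i {ω | 0 < ξ t ω} := by
    by_contra! hcon
    obtain ⟨i, hi⟩ := hcon
    simp only [nonpos_iff_eq_zero] at hi
    have hall : ∀ j t, P 0 j {ω | 0 < ξ t ω} = 0 := fun j => by
      induction hirr i j with
      | refl => exact hi
      | tail _ hr ih => exact h.measure_pos_eq_zero_of_rate_pos hpar ih hr
    refine D.not_nonConstant_of_generator_arctan (fun j => ?_) hnc
    have h1 := hpar (fun _ => Real.arctan) (fun _ => Real.contDiff_arctan)
      ⟨Real.pi / 2, fun _ x => ⟨abs_le.2 ⟨(Real.neg_pi_div_two_lt_arctan x).le,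
        (Real.arctan_lt_pi_div_two x).le⟩, by
          rw [Real.deriv_arctan, abs_of_pos (by positivity), div_le_iff₀ (by positivity)]
          nlinarith [Real.pi_gt_three, sq_nonneg x]⟩⟩ 0 j
    refine tendsto_nhds_unique h1 (tendsto_const_nhds.congr fun t => ?_)
    have h0 : ∫ ω, Real.arctan (ξ t ω) ∂(P 0 j) = 0 := by
      refine integral_eq_zero_of_ae ?_
      filter_upwards [h.ae_pos_nonneg j, (ae_iff (p := fun ω => ¬ 0 < ξ t ω)).2
        (by simpa using hall j t)] with ω h1 h2
      have : ξ t ω = 0 := le_antisymm (not_lt.1 h2) (h1 t)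
      simp [this]
    simp [h0]
  choose τ hτ using hex
  -- By monotonicity any time dominating all the `τ i` serves every type; the `1` makes it positive.
  refine ⟨1 + ∑ i, τ i, by positivity, fun i => (hτ i).trans_le (measure_mono fun ω hω => ?_)⟩
  have hle : τ i ≤ 1 + ∑ i, τ i :=
    (Finset.single_le_sum (fun _ _ => zero_le) (Finset.mem_univ i)).trans le_add_self
  exact lt_of_lt_of_le hω (h.monotone_pos ω hle)

/-- Each expectation is strictly below `1`, and there are finitely many types, so their supremum is
too. -/
theorem exists_lintegral_exp_neg_le (h : IsMAP P ξ J) {T : ℝ≥0}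
    (hT : ∀ i, 0 < P 0 i {ω | 0 < ξ T ω}) :
    ∃ a < 1, ∀ i, ∫⁻ ω, ENNReal.ofReal (Real.exp (-ξ T ω)) ∂(P 0 i) ≤ a := by
  refine ⟨Finset.univ.sup fun i => ∫⁻ ω, ENNReal.ofReal (Real.exp (-ξ T ω)) ∂(P 0 i),
    (Finset.sup_lt_iff zero_lt_one).2 fun i _ => ?_, fun i => Finset.le_sup
      (f := fun i => ∫⁻ ω, ENNReal.ofReal (Real.exp (-ξ T ω)) ∂(P 0 i)) (Finset.mem_univ i)⟩
  have := h.prob 0 i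
  have hle : ∀ᵐ ω ∂(P 0 i), ENNReal.ofReal (Real.exp (-ξ T ω)) ≤ 1 := by
    filter_upwards [h.ae_pos_nonneg i] with ω hω
    rw [ENNReal.ofReal_le_one]
    exact Real.exp_le_one_iff.2 (neg_nonpos.2 (hω T))
  have hne : ∫⁻ ω, ENNReal.ofReal (Real.exp (-ξ T ω)) ∂(P 0 i) ≠ ∞ := by
    refine ((lintegral_mono_ae hle).trans_lt ?_).ne
    simp
  have := lintegral_strict_mono_of_ae_le_of_ae_lt_on (μ := P 0 i)
    (f := fun ω => ENNReal.ofReal (Real.exp (-ξ T ω))) (g := fun _ => 1) aemeasurable_const hne hle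
    (s := {ω | 0 < ξ T ω}) (hT i).ne' (ae_of_all _ fun ω hω => by
      rw [ENNReal.ofReal_lt_one]
      exact Real.exp_lt_one_iff.2 (neg_lt_zero.2 hω))
  simpa using this

/-- On the block `(nT, (n+1)T]` the integrand is at most `e^{-ξ_{nT}}`, whose mean is at most `a^n`
by the Markov property. -/
theorem lintegral_expFunctional_lt_top (h : IsMAP P ξ J) (hpar : HasParameters P ξ J D)
    (hirr : D.Irreducible) (hnc : D.NonConstant) (i : Fin K) :
    ∫⁻ ω, expFunctional ξ ω ∂(P 0 i) < ∞ := by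
  obtain ⟨T, hT0, hT⟩ := h.exists_measure_pos hpar hirr hnc
  obtain ⟨a, ha, haT⟩ := h.exists_lintegral_exp_neg_le hT
  have hpow := h.lintegral_pos_le_pow (g := fun x => ENNReal.ofReal (Real.exp (-x)))
    (by fun_prop) (fun x y _ _ => by
      rw [← ENNReal.ofReal_mul (Real.exp_pos _).le, ← Real.exp_add, neg_add]) (by simp) haT
  have hI : ∀ ω, expFunctional ξ ω ≤
      ∑' n : ℕ, ENNReal.ofReal (Real.exp (-ξ (n * T) ω)) * T := fun ω => by
    have hcov : Set.Ioi (0 : ℝ) ⊆ ⋃ n : ℕ, Set.Ioc (n * T : ℝ) ((n + 1) * T) := fun s hs => by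
      have hs : (0 : ℝ) < s := hs
      have hT0' : (0 : ℝ) < T := hT0
      obtain ⟨n, hn⟩ := Nat.exists_eq_add_of_lt (Nat.ceil_pos.2 (div_pos hs hT0'))
      rw [zero_add] at hn
      have h1 := Nat.ceil_lt_add_one (div_pos hs hT0').le
      have h2 := Nat.le_ceil (s / T)
      rw [hn] at h1 h2
      push_cast at h1 h2
      refine Set.mem_iUnion.2 ⟨n, ?_, ?_⟩
      · rw [← lt_div_iff₀ hT0']; linarith
      · rwa [← div_le_iff₀ hT0']
    calc expFunctional ξ ω
        ≤ ∫⁻ s in ⋃ n : ℕ, Set.Ioc (n * T : ℝ) ((n + 1) * T),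
            ENNReal.ofReal (Real.exp (-ξ s.toNNReal ω)) := lintegral_mono_set hcov
      _ ≤ ∑' n : ℕ, ∫⁻ s in Set.Ioc (n * T : ℝ) ((n + 1) * T),
            ENNReal.ofReal (Real.exp (-ξ s.toNNReal ω)) := lintegral_iUnion_le _ _
      _ ≤ ∑' n : ℕ, ENNReal.ofReal (Real.exp (-ξ (n * T) ω)) * T := by
        refine ENNReal.tsum_le_tsum fun n => ?_
        refine (setLIntegral_mono' (g := fun _ => ENNReal.ofReal (Real.exp (-ξ (n * T) ω)))
          measurableSet_Ioc fun s hs => ?_).trans ?_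
        · refine ENNReal.ofReal_le_ofReal (Real.exp_le_exp.2 (neg_le_neg (h.monotone_pos ω ?_)))
          rw [← NNReal.coe_le_coe]
          push_cast
          exact hs.1.le.trans (Real.le_coe_toNNReal s)
        · rw [setLIntegral_const, Real.volume_Ioc]
          refine le_of_eq ?_
          congr 1
          rw [show ((n : ℝ) + 1) * T - n * T = T by ring, ENNReal.ofReal_coe_nnreal]
  calc ∫⁻ ω, expFunctional ξ ω ∂(P 0 i)
      ≤ ∫⁻ ω, ∑' n : ℕ, ENNReal.ofReal (Real.exp (-ξ (n * T) ω)) * T ∂(P 0 i) := lintegral_mono hI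
    _ = ∑' n : ℕ, (∫⁻ ω, ENNReal.ofReal (Real.exp (-ξ (n * T) ω)) ∂(P 0 i)) * T := by
        have hm : ∀ n : ℕ, Measurable fun ω =>
            ENNReal.ofReal (Real.exp (-ξ (n * T) ω)) * (T : ℝ≥0∞) := fun n =>
          (Real.measurable_exp.comp (h.measurable_pos _).neg).ennreal_ofReal.mul_const _
        rw [lintegral_tsum fun n => (hm n).aemeasurable]
        refine tsum_congr fun n => ?_
        rw [lintegral_mul_const' _ _ ENNReal.coe_ne_top]
    _ ≤ ∑' n : ℕ, a ^ n * T := by gcongr with n; exact hpow n i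
    _ = (1 - a)⁻¹ * T := by rw [ENNReal.tsum_mul_right, ENNReal.tsum_geometric]
    _ < ∞ := by
        refine ENNReal.mul_lt_top ?_ ENNReal.coe_lt_top
        rw [ENNReal.inv_lt_top]
        exact tsub_pos_of_lt ha

theorem ofReal_exp_neg_le_expFunctional (h : IsMAP P ξ J) (ω : Ω) :
    ENNReal.ofReal (Real.exp (-ξ 1 ω)) ≤ expFunctional ξ ω := by
  calc ENNReal.ofReal (Real.exp (-ξ 1 ω))
      = ∫⁻ s in Set.Ioc (0 : ℝ) 1, ENNReal.ofReal (Real.exp (-ξ 1 ω)) := by simp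
    _ ≤ ∫⁻ s in Set.Ioc (0 : ℝ) 1, ENNReal.ofReal (Real.exp (-ξ s.toNNReal ω)) := by
        refine setLIntegral_mono' measurableSet_Ioc fun s hs => ?_
        refine ENNReal.ofReal_le_ofReal (Real.exp_le_exp.2 (neg_le_neg (h.monotone_pos ω ?_)))
        exact Real.toNNReal_le_one.2 hs.2
    _ ≤ expFunctional ξ ω := lintegral_mono_set Set.Ioc_subset_Ioi_self

theorem expFunctional_pos (h : IsMAP P ξ J) (ω : Ω) : 0 < expFunctional ξ ω :=
  (ENNReal.ofReal_pos.2 (Real.exp_pos _)).trans_le (h.ofReal_exp_neg_le_expFunctional ω)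

theorem ae_expFunctional_lt_top (h : IsMAP P ξ J) (hpar : HasParameters P ξ J D)
    (hirr : D.Irreducible) (hnc : D.NonConstant) (i : Fin K) :
    ∀ᵐ ω ∂(P 0 i), expFunctional ξ ω < ∞ :=
  ae_lt_top h.measurable_expFunctional (h.lintegral_expFunctional_lt_top hpar hirr hnc i).ne

end IsMAP

end

/-! ### The integrated moment identity -/

/-- Chain rule for the tail integrals of a positive non-increasing right-continuous function. -/
theorem integral_deriv_comp_tail {w : ℝ → ℝ} (hw : ∀ s, 0 < w s) (hanti : Antitone w)
    (hrc : ∀ s, ContinuousWithinAt w (Set.Ici s) s) (hint : IntegrableOn w (Set.Ioi 0))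
    {φ φ' : ℝ → ℝ} (hφ : ∀ x, 0 < x → HasDerivAt φ (φ' x) x)
    (hφ' : ContinuousOn φ' (Set.Ioi 0)) {t : ℝ} (ht : 0 ≤ t) :
    IntervalIntegrable (fun s => φ' (∫ u in Set.Ioi s, w u) * w s) volume 0 t ∧
      ∫ s in (0 : ℝ)..t, φ' (∫ u in Set.Ioi s, w u) * w s =
        φ (∫ u in Set.Ioi 0, w u) - φ (∫ u in Set.Ioi t, w u) := by
  set F : ℝ → ℝ := fun s => ∫ u in Set.Ioi s, w u with hF
  have hFpos : ∀ s, 0 ≤ s → 0 < F s := fun s hs => by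
    rw [hF, integral_pos_iff_support_of_nonneg (fun u => (hw u).le)
      (hint.mono_set (Set.Ioi_subset_Ioi hs))]
    have : Function.support w = Set.univ := Set.eq_univ_of_forall fun u => (hw u).ne'
    simp [this]
  have hii : ∀ a b, IntervalIntegrable w volume a b := fun a b =>
    (hanti.antitoneOn _).intervalIntegrable
  have hFeq : ∀ s, 0 ≤ s → F s = F 0 - ∫ u in (0 : ℝ)..s, w u := fun s hs => by
    rw [← intervalIntegral.integral_Ioi_sub_Ioi hint hs]; simp [hF]
  have hcont : ContinuousOn F (Set.uIcc 0 t) := by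
    rw [Set.uIcc_of_le ht]
    have : ContinuousOn (fun s => F 0 - ∫ u in (0 : ℝ)..s, w u) (Set.Icc 0 t) :=
      (continuous_const.sub (intervalIntegral.continuous_primitive hii 0)).continuousOn
    exact this.congr fun s hs => hFeq s hs.1
  have hFmem : ∀ s ∈ Set.uIcc 0 t, F s ∈ Set.Ioi (0 : ℝ) := fun s hs => by
    rw [Set.uIcc_of_le ht] at hs; exact hFpos s hs.1
  have hI : IntervalIntegrable (fun s => φ' (F s) * w s) volume 0 t :=
    (hii 0 t).continuousOn_mul (hφ'.comp hcont hFmem)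
  refine ⟨hI, ?_⟩
  have hφc : ContinuousOn φ (Set.Ioi 0) := fun x hx => (hφ x hx).continuousAt.continuousWithinAt
  -- `w` may jump, so the tail integral has only a right derivative `-w`; with continuity this
  -- suffices for the fundamental theorem.
  have key := intervalIntegral.integral_eq_sub_of_hasDeriv_right (f := fun s => φ (F s))
    (f' := fun s => φ' (F s) * (-w s)) (a := 0) (b := t) (hφc.comp hcont hFmem)
    (fun s hs => by
      rw [min_eq_left ht, max_eq_right ht] at hs
      have h1 : HasDerivWithinAt (fun s => F 0 - ∫ u in (0 : ℝ)..s, w u) (-w s) (Set.Ioi s) s := by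
        have := (intervalIntegral.integral_hasDerivWithinAt_right (hii 0 s) (s := Set.Ici s)
          (t := Set.Ioi s) (hanti.measurable.stronglyMeasurable.stronglyMeasurableAtFilter)
          ((hrc s).mono Set.Ioi_subset_Ici_self)).const_sub (F 0)
        exact this.mono Set.Ioi_subset_Ici_self
      have h2 : HasDerivWithinAt F (-w s) (Set.Ioi s) s :=
        h1.congr (fun u hu => hFeq u (hs.1.le.trans (le_of_lt hu))) (hFeq s hs.1.le)
      exact (hφ _ (hFpos s hs.1.le)).comp_hasDerivWithinAt s h2)
    (hI.neg.congr fun s _ => by simp)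
  simp only [mul_neg, intervalIntegral.integral_neg] at key
  linarith

section

variable {K : ℕ} {Ω : Type*} [MeasurableSpace Ω]

/-- `E_i[e^{qξ_t}; J_t = j]`. -/
noncomputable def typeExp (P : ℝ → Fin K → Measure Ω) (ξ : ℝ≥0 → Ω → ℝ) (J : ℝ≥0 → Ω → Fin K)
    (q : ℝ) (i j : Fin K) (t : ℝ≥0) : ℝ≥0∞ :=
  ∫⁻ ω in {ω | J t ω = j}, ENNReal.ofReal (Real.exp (q * ξ t ω)) ∂(P 0 i)

theorem tailFunctional_zero {Ω' : Type*} (ξ : ℝ≥0 → Ω' → ℝ) : tailFunctional ξ 0 = expFunctional ξ := rfl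

namespace IsMAP

variable {P : ℝ → Fin K → Measure Ω} {ξ : ℝ≥0 → Ω → ℝ} {J : ℝ≥0 → Ω → Fin K} {D : MAPData K}

theorem antitone_discount (h : IsMAP P ξ J) (ω : Ω) : Antitone fun s => discount ξ s ω :=
  fun _ _ hst => Real.exp_le_exp.2 (neg_le_neg (h.monotone_pos ω (Real.toNNReal_le_toNNReal hst)))

theorem rightCont_discount (h : IsMAP P ξ J) (ω : Ω) (s : ℝ) :
    ContinuousWithinAt (fun s => discount ξ s ω) (Set.Ici s) s := by
  have h1 : ContinuousWithinAt (fun u : ℝ => ξ u.toNNReal ω) (Set.Ici s) s :=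
    (h.rightCont_pos ω s.toNNReal).comp continuous_real_toNNReal.continuousWithinAt
      fun u hu => Real.toNNReal_le_toNNReal hu
  exact Real.continuous_exp.continuousAt.comp_continuousWithinAt h1.neg

theorem integrableOn_discount (h : IsMAP P ξ J) {ω : Ω} (hω : expFunctional ξ ω < ∞) :
    IntegrableOn (fun s => discount ξ s ω) (Set.Ioi 0) := by
  refine ⟨(h.antitone_discount ω).measurable.aestronglyMeasurable, ?_⟩
  rw [hasFiniteIntegral_iff_ofReal (f := fun s => discount ξ s ω)
    (ae_of_all _ fun s => (Real.exp_pos _).le)]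
  exact hω

theorem integral_discount (h : IsMAP P ξ J) (t : ℝ) (ω : Ω) :
    ∫ s in Set.Ioi t, discount ξ s ω = (tailFunctional ξ t ω).toReal :=
  integral_eq_lintegral_of_nonneg_ae (ae_of_all _ fun _ => (Real.exp_pos _).le)
    (h.antitone_discount ω).measurable.aestronglyMeasurable

theorem tailFunctional_lt_top {Ω' : Type*} {ξ : ℝ≥0 → Ω' → ℝ} {ω : Ω'} (hω : expFunctional ξ ω < ∞) {t : ℝ}
    (ht : 0 ≤ t) : tailFunctional ξ t ω < ∞ :=
  (lintegral_mono_set (Set.Ioi_subset_Ioi ht)).trans_lt hω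

theorem tailFunctional_pos (h : IsMAP P ξ J) (t : ℝ) (ω : Ω) : 0 < tailFunctional ξ t ω := by
  unfold tailFunctional
  rw [setLIntegral_pos_iff (h.antitone_discount ω).measurable.ennreal_ofReal]
  have : (Function.support fun s => ENNReal.ofReal (discount ξ s ω)) = Set.univ :=
    Set.eq_univ_of_forall fun s => by
      simpa [discount] using Real.exp_pos _
  simp [this]

theorem lintegral_tail_rpow (h : IsMAP P ξ J) {φ : ℝ → ℝ} {q : ℝ}
    (hφ : ∀ x, 0 < x → HasDerivAt φ (x ^ (-q - 1)) x) {ω : Ω} (hω : expFunctional ξ ω < ∞)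
    {t : ℝ} (ht : 0 ≤ t) :
    0 ≤ φ (expFunctional ξ ω).toReal - φ (tailFunctional ξ t ω).toReal ∧
    ∫⁻ s in Set.Ioc 0 t, tailFunctional ξ s ω ^ (-q - 1) * ENNReal.ofReal (discount ξ s ω) =
      ENNReal.ofReal (φ (expFunctional ξ ω).toReal - φ (tailFunctional ξ t ω).toReal) := by
  obtain ⟨h1, h2⟩ := integral_deriv_comp_tail (w := fun s => discount ξ s ω)
    (fun s => Real.exp_pos _) (h.antitone_discount ω)
    (h.rightCont_discount ω) (h.integrableOn_discount hω) hφ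
    (fun x hx => (Real.continuousAt_rpow_const x _ (Or.inl (ne_of_gt hx))).continuousWithinAt) ht
  simp only [h.integral_discount] at h1 h2
  rw [tailFunctional_zero] at h2
  rw [intervalIntegral.integral_of_le ht] at h2
  have hnn : ∀ s, 0 ≤ (tailFunctional ξ s ω).toReal ^ (-q - 1) * discount ξ s ω := fun s =>
    mul_nonneg (Real.rpow_nonneg ENNReal.toReal_nonneg _) (Real.exp_pos _).le
  rw [← h2]
  refine ⟨integral_nonneg hnn, ?_⟩
  rw [ofReal_integral_eq_lintegral_ofReal ((intervalIntegrable_iff_integrableOn_Ioc_of_le ht).1 h1)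
    (ae_of_all _ hnn)]
  refine setLIntegral_congr_fun measurableSet_Ioc fun s hs => ?_
  rw [ENNReal.ofReal_mul (Real.rpow_nonneg ENNReal.toReal_nonneg _),
    ← ENNReal.ofReal_rpow_of_pos (ENNReal.toReal_pos (h.tailFunctional_pos s ω).ne'
      (tailFunctional_lt_top hω hs.1.le).ne),
    ENNReal.ofReal_toReal (tailFunctional_lt_top hω hs.1.le).ne]

theorem ofReal_exp_rpow (x r : ℝ) :
    ENNReal.ofReal (Real.exp x) ^ r = ENNReal.ofReal (Real.exp (r * x)) := by
  rw [ENNReal.ofReal_rpow_of_pos (Real.exp_pos _), ← Real.exp_mul, mul_comm]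

theorem tailFunctional_rpow (h : IsMAP P ξ J) (ω : Ω) {t : ℝ} (ht : 0 ≤ t) (r : ℝ) :
    tailFunctional ξ t ω ^ r = ENNReal.ofReal (Real.exp (-r * ξ t.toNNReal ω)) *
      pathFunctional (shiftedPath ξ J t.toNNReal ω) ^ r := by
  have h0 := h.tailFunctional_pos t ω
  rw [h.tailFunctional_eq ht ω] at h0 ⊢
  rw [ENNReal.mul_rpow_of_ne_zero (by simpa [discount] using Real.exp_pos _)
    (right_ne_zero_of_mul h0.ne'), discount, ofReal_exp_rpow]
  congr 3; ring

theorem lintegral_moment (h : IsMAP P ξ J) (r : ℝ) (j : Fin K) :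
    ∫⁻ ω, pathFunctional (mapPath ξ J ω) ^ r ∂(P 0 j) = moment P ξ r j := by
  unfold moment
  simp only [h.expFunctional_eq]

theorem lintegral_exp_mul_moment (h : IsMAP P ξ J) (q r : ℝ) (i : Fin K) (t : ℝ≥0) :
    ∫⁻ ω, ENNReal.ofReal (Real.exp (q * ξ t ω)) *
        pathFunctional (shiftedPath ξ J t ω) ^ r ∂(P 0 i) =
      ∑ j, typeExp P ξ J q i j t * moment P ξ r j := by
  rw [h.lintegral_pos_mul_shiftedPath (g := fun x => ENNReal.ofReal (Real.exp (q * x)))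
    (H := fun x => pathFunctional x ^ r) 0 i t (by fun_prop)
    (measurable_pathFunctional.pow_const r)]
  simp only [h.lintegral_moment, typeExp]

/-- The integrated form of the moment recursion. -/
theorem lintegral_sub_tail (h : IsMAP P ξ J) {i : Fin K}
    (hfin : ∀ᵐ ω ∂(P 0 i), expFunctional ξ ω < ∞) {φ : ℝ → ℝ} {q : ℝ}
    (hφ : ∀ x, 0 < x → HasDerivAt φ (x ^ (-q - 1)) x) {t : ℝ} (ht : 0 ≤ t) :
    ∫⁻ ω, ENNReal.ofReal (φ (expFunctional ξ ω).toReal - φ (tailFunctional ξ t ω).toReal) ∂(P 0 i) =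
      ∫⁻ s in Set.Ioc 0 t, ∑ j, typeExp P ξ J q i j s.toNNReal * moment P ξ (-q - 1) j := by
  have := h.prob 0 i
  calc _ = ∫⁻ ω, (∫⁻ s in Set.Ioc 0 t, tailFunctional ξ s ω ^ (-q - 1) *
        ENNReal.ofReal (discount ξ s ω)) ∂(P 0 i) := by
        refine lintegral_congr_ae ?_
        filter_upwards [hfin] with ω hω using (h.lintegral_tail_rpow hφ hω ht).2.symm
    _ = ∫⁻ s in Set.Ioc 0 t, ∫⁻ ω, tailFunctional ξ s ω ^ (-q - 1) *
        ENNReal.ofReal (discount ξ s ω) ∂(P 0 i) := by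
        refine lintegral_lintegral_swap (Measurable.aemeasurable ?_)
        exact (h.measurable_tailFunctional.pow_const _).mul h.measurable_discount.ennreal_ofReal
    _ = _ := by
        refine setLIntegral_congr_fun measurableSet_Ioc fun s hs => ?_
        rw [← h.lintegral_exp_mul_moment]
        refine lintegral_congr_ae ?_
        filter_upwards [hfin] with ω hω
        -- The exponents combine as `(q + 1)ξ_s - ξ_s = qξ_s`.
        rw [h.tailFunctional_rpow ω hs.1.le, discount, mul_right_comm,
          ← ENNReal.ofReal_mul (Real.exp_pos _).le, ← Real.exp_add]
        congr 3; ring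

end IsMAP

end

/-! ### The recursion, by differentiation at time zero -/

/-- Averages over `(0, t]` converge, as `t → 0`, to the limit of the integrand. -/
theorem tendsto_lintegral_Ioc_div {u : ℝ → ℝ≥0∞} {ℓ : ℝ≥0∞} (hu : Tendsto u (𝓝[>] 0) (𝓝 ℓ)) :
    Tendsto (fun t => (∫⁻ s in Set.Ioc 0 t, u s) / ENNReal.ofReal t) (𝓝[>] 0) (𝓝 ℓ) := by
  have hconst : ∀ (c : ℝ≥0∞) {t : ℝ}, 0 < t →
      (∫⁻ _ in Set.Ioc 0 t, c) / ENNReal.ofReal t = c := fun c t ht => by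
    rw [setLIntegral_const, Real.volume_Ioc, sub_zero]
    exact ENNReal.mul_div_cancel_right (by simpa using ht) ENNReal.ofReal_ne_top
  refine tendsto_order.2 ⟨fun b hb => ?_, fun b hb => ?_⟩
  · obtain ⟨c, hbc, hc⟩ := exists_between hb
    obtain ⟨δ, hδ, hδu⟩ := mem_nhdsGT_iff_exists_Ioo_subset.1 (hu.eventually_const_lt hc)
    filter_upwards [Ioo_mem_nhdsGT hδ] with t ht
    refine hbc.trans_le ?_
    rw [← hconst c ht.1]
    exact ENNReal.div_le_div_right (setLIntegral_mono' measurableSet_Ioc fun s hs =>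
      le_of_lt (hδu ⟨hs.1, hs.2.trans_lt ht.2⟩)) _
  · obtain ⟨c, hc, hcb⟩ := exists_between hb
    obtain ⟨δ, hδ, hδu⟩ := mem_nhdsGT_iff_exists_Ioo_subset.1 (hu.eventually_lt_const hc)
    filter_upwards [Ioo_mem_nhdsGT hδ] with t ht
    refine lt_of_le_of_lt ?_ hcb
    rw [← hconst c ht.1]
    exact ENNReal.div_le_div_right (setLIntegral_mono' measurableSet_Ioc fun s hs =>
      le_of_lt (hδu ⟨hs.1, hs.2.trans_lt ht.2⟩)) _

theorem tendsto_toNNReal_nhdsGT : Tendsto Real.toNNReal (𝓝[>] 0) (𝓝[>] 0) := by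
  refine tendsto_nhdsWithin_iff.2 ⟨?_, ?_⟩
  · exact (continuous_real_toNNReal.tendsto' 0 0 (by simp)).mono_left nhdsWithin_le_nhds
  · filter_upwards [self_mem_nhdsWithin] with t ht
    simpa using ht

section

variable {K : ℕ} {Ω : Type*} [MeasurableSpace Ω]

namespace IsMAP

variable {P : ℝ → Fin K → Measure Ω} {ξ : ℝ≥0 → Ω → ℝ} {J : ℝ≥0 → Ω → Fin K} {D : MAPData K}

theorem typeExp_toReal (h : IsMAP P ξ J) (q : ℝ) (i j : Fin K) (t : ℝ≥0) :
    (typeExp P ξ J q i j t).toReal = ∫ ω in {ω | J t ω = j}, Real.exp (q * ξ t ω) ∂(P 0 i) :=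
  (integral_eq_lintegral_of_nonneg_ae (ae_of_all _ fun _ => (Real.exp_pos _).le)
    (Real.measurable_exp.comp ((h.measurable_pos t).const_mul q)).aestronglyMeasurable).symm

theorem typeExp_lt_top (h : IsMAP P ξ J) (hpar : HasParameters P ξ J D) {q Q : ℝ} (hq : 0 ≤ q)
    (hqQ : q < Q) (hQ : D.ExpMoment Q) (i j : Fin K) (t : ℝ≥0) :
    typeExp P ξ J q i j t < ∞ := by
  obtain ⟨C, -, hC⟩ := h.lintegral_exp_le hpar hq hqQ hQ
  exact (setLIntegral_le_lintegral _ _).trans_lt ((hC t i).trans_lt ENNReal.ofReal_lt_top)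

theorem tendsto_typeExp_div (h : IsMAP P ξ J) (hpar : HasParameters P ξ J D) {q Q : ℝ}
    (hq : 0 ≤ q) (hqQ : q < Q) (hQ : D.ExpMoment Q) (i j : Fin K) :
    Tendsto (fun t : ℝ≥0 => ((typeExp P ξ J q i j t).toReal - (if i = j then 1 else 0)) / (t : ℝ))
      (𝓝[>] 0) (𝓝 (-D.bernstein (-q) i j)) := by
  simp only [h.typeExp_toReal]
  exact h.tendsto_exp_type hpar hq hqQ hQ i j

theorem tendsto_typeExp (h : IsMAP P ξ J) (hpar : HasParameters P ξ J D) {q Q : ℝ}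
    (hq : 0 ≤ q) (hqQ : q < Q) (hQ : D.ExpMoment Q) (i j : Fin K) :
    Tendsto (typeExp P ξ J q i j) (𝓝[>] 0) (𝓝 (if i = j then 1 else 0)) := by
  have h0 : Tendsto (fun t : ℝ≥0 => (t : ℝ)) (𝓝[>] 0) (𝓝 0) :=
    (NNReal.continuous_coe.tendsto' 0 0 (by simp)).mono_left nhdsWithin_le_nhds
  have h1 := ((h.tendsto_typeExp_div hpar hq hqQ hQ i j).mul h0).add_const
    (if i = j then (1 : ℝ) else 0)
  rw [← ENNReal.tendsto_toReal_iff (fun t => (h.typeExp_lt_top hpar hq hqQ hQ i j t).ne)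
    (by split_ifs <;> simp)]
  rw [mul_zero, zero_add] at h1
  convert h1.congr' _ using 2
  · split_ifs <;> simp
  · filter_upwards [self_mem_nhdsWithin] with t ht
    have : (t : ℝ) ≠ 0 := (NNReal.coe_pos.2 ht).ne'
    rw [div_mul_cancel₀ _ this, sub_add_cancel]

/-- One step of the recursion: the moment of order `-q - 1` is finite and is the derivative at
`t = 0` of `E_i[φ(I) - φ(I_t)]`, for a primitive `φ` of `x ^ (-q - 1)`. -/
theorem moment_eq_of_tendsto (h : IsMAP P ξ J) (hpar : HasParameters P ξ J D) {q Q : ℝ}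
    (hq : 0 ≤ q) (hqQ : q < Q) (hQ : D.ExpMoment Q)
    (hfin : ∀ i, ∀ᵐ ω ∂(P 0 i), expFunctional ξ ω < ∞) {φ : ℝ → ℝ}
    (hφ : ∀ x, 0 < x → HasDerivAt φ (x ^ (-q - 1)) x)
    (hint : ∀ i (t : ℝ≥0), Integrable (fun ω =>
      φ (expFunctional ξ ω).toReal - φ (tailFunctional ξ t ω).toReal) (P 0 i)) {v : Fin K → ℝ}
    (hv : ∀ i, Tendsto (fun t : ℝ≥0 => (∫ ω, (φ (expFunctional ξ ω).toReal -
      φ (tailFunctional ξ t ω).toReal) ∂(P 0 i)) / (t : ℝ)) (𝓝[>] 0) (𝓝 (v i))) :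
    (∀ i, moment P ξ (-q - 1) i < ∞) ∧ momentVec P ξ (-q - 1) = v := by
  set R : Fin K → ℝ≥0 → ℝ := fun i t => ∫ ω, (φ (expFunctional ξ ω).toReal -
      φ (tailFunctional ξ t ω).toReal) ∂(P 0 i) with hRdef
  set u : Fin K → ℝ → ℝ≥0∞ := fun i s =>
    ∑ j, typeExp P ξ J q i j s.toNNReal * moment P ξ (-q - 1) j
  have hnn : ∀ i (t : ℝ≥0), ∀ᵐ ω ∂(P 0 i), 0 ≤ φ (expFunctional ξ ω).toReal -
      φ (tailFunctional ξ t ω).toReal := fun i t => by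
    filter_upwards [hfin i] with ω hω using (h.lintegral_tail_rpow hφ hω t.coe_nonneg).1
  have hRu : ∀ i (t : ℝ≥0), ENNReal.ofReal (R i t) = ∫⁻ s in Set.Ioc 0 (t : ℝ), u i s :=
    fun i t => by
      rw [hRdef, ofReal_integral_eq_lintegral_ofReal (hint i t) (hnn i t)]
      exact h.lintegral_sub_tail (hfin i) hφ t.coe_nonneg
  have htype : ∀ i j, Tendsto (fun s : ℝ => typeExp P ξ J q i j s.toNNReal) (𝓝[>] 0)
      (𝓝 (if i = j then 1 else 0)) := fun i j =>
    (h.tendsto_typeExp hpar hq hqQ hQ i j).comp tendsto_toNNReal_nhdsGT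
  -- Near time `0` the diagonal weight exceeds `1/2`, so an infinite moment would make the integral
  -- infinite, while it equals a finite expectation.
  have hlt : ∀ i, moment P ξ (-q - 1) i < ∞ := fun i => by
    have h1 := htype i i
    rw [if_pos rfl] at h1
    obtain ⟨δ, hδ, hδu⟩ := mem_nhdsGT_iff_exists_Ioc_subset.1
      (h1.eventually_const_lt (u := 1 / 2) (ENNReal.half_lt_self one_ne_zero ENNReal.one_ne_top))
    have hδ0 : (0 : ℝ) < δ := hδ
    have h2 : ENNReal.ofReal δ * (1 / 2 * moment P ξ (-q - 1) i) ≤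
        ENNReal.ofReal (R i δ.toNNReal) := by
      rw [hRu, Real.coe_toNNReal _ hδ0.le]
      calc ENNReal.ofReal δ * (1 / 2 * moment P ξ (-q - 1) i)
          = ∫⁻ _ in Set.Ioc 0 δ, 1 / 2 * moment P ξ (-q - 1) i := by
            rw [setLIntegral_const, Real.volume_Ioc, sub_zero, mul_comm]
        _ ≤ ∫⁻ s in Set.Ioc 0 δ, u i s := by
            refine setLIntegral_mono' measurableSet_Ioc fun s hs => ?_
            refine le_trans ?_ (Finset.single_le_sum
              (f := fun j => typeExp P ξ J q i j s.toNNReal * moment P ξ (-q - 1) j)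
              (fun _ _ => zero_le) (Finset.mem_univ i))
            gcongr
            exact le_of_lt (hδu hs)
    by_contra hcon
    rw [not_lt, top_le_iff] at hcon
    rw [hcon, ENNReal.mul_top (by simp), ENNReal.mul_top (by simpa using hδ0)] at h2
    exact ENNReal.ofReal_ne_top (top_le_iff.1 h2)
  refine ⟨hlt, funext fun i => ?_⟩
  have hu : Tendsto (u i) (𝓝[>] 0) (𝓝 (moment P ξ (-q - 1) i)) := by
    have := tendsto_finsetSum Finset.univ fun j (_ : j ∈ Finset.univ) =>
      ENNReal.Tendsto.mul_const (b := moment P ξ (-q - 1) j) (htype i j) (Or.inr (hlt j).ne)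
    simpa using this
  have h1 := (ENNReal.tendsto_toReal (hlt i).ne).comp (tendsto_lintegral_Ioc_div hu)
  refine tendsto_nhds_unique h1 (((hv i).comp tendsto_toNNReal_nhdsGT).congr' ?_)
  filter_upwards [self_mem_nhdsWithin] with t ht
  have ht0 : (0 : ℝ) < t := ht
  have h2 := hRu i t.toNNReal
  rw [Real.coe_toNNReal _ ht0.le] at h2
  simp only [Function.comp_apply, Real.coe_toNNReal _ ht0.le]
  rw [← h2, ENNReal.toReal_div, ENNReal.toReal_ofReal ht0.le,
    ENNReal.toReal_ofReal (integral_nonneg_of_ae (hnn i _))]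
  simp only [Real.coe_toNNReal _ ht0.le]

/-- A signed version of the Markov factorisation, needed for the logarithm; `typeExp` at `q = 0` is
the probability of `J_t = j`. -/
theorem integral_shiftedPath (h : IsMAP P ξ J) (i : Fin K) (t : ℝ≥0)
    {g : (ℝ≥0 → ℝ × Fin K) → ℝ} (hg : Measurable g)
    (hint : ∀ j, Integrable (fun ω => g (mapPath ξ J ω)) (P 0 j)) :
    Integrable (fun ω => g (shiftedPath ξ J t ω)) (P 0 i) ∧
      ∫ ω, g (shiftedPath ξ J t ω) ∂(P 0 i) =
        ∑ j, (typeExp P ξ J 0 i j t).toReal * ∫ ω, g (mapPath ξ J ω) ∂(P 0 j) := by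
  have := h.prob 0 i
  have hmap : ∀ j, Integrable g
      (((P 0 i).restrict {ω | J t ω = j}).map (shiftedPath ξ J t)) := fun j => by
    rw [h.map_shiftedPath_snd]
    refine Integrable.smul_measure ?_ (measure_ne_top _ _)
    exact (integrable_map_measure hg.aestronglyMeasurable
      h.measurable_mapPath.aemeasurable).2 (hint j)
  have hU : ⋃ j, {ω | J t ω = j} = Set.univ := by ext ω; simp
  have hI : Integrable (fun ω => g (shiftedPath ξ J t ω)) (P 0 i) := by
    rw [← integrableOn_univ, ← hU, integrableOn_finite_iUnion]
    exact fun j => (integrable_map_measure hg.aestronglyMeasurable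
      (h.measurable_shiftedPath t).aemeasurable).1 (hmap j)
  refine ⟨hI, ?_⟩
  rw [h.integral_eq_sum_type i t hI]
  refine Finset.sum_congr rfl fun j _ => ?_
  rw [← integral_map (f := g) (h.measurable_shiftedPath t).aemeasurable hg.aestronglyMeasurable,
    h.map_shiftedPath_snd, integral_smul_measure,
    integral_map h.measurable_mapPath.aemeasurable hg.aestronglyMeasurable]
  simp [typeExp]

/-- The recursion `q N(-q - 1) = -Φ(-q) N(-q)`. -/
theorem moment_step (h : IsMAP P ξ J) (hpar : HasParameters P ξ J D) {q Q : ℝ}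
    (hq : 0 < q) (hqQ : q < Q) (hQ : D.ExpMoment Q)
    (hfin : ∀ i, ∀ᵐ ω ∂(P 0 i), expFunctional ξ ω < ∞)
    (hmom : ∀ i, moment P ξ (-q) i < ∞) :
    (∀ i, moment P ξ (-q - 1) i < ∞) ∧
      momentVec P ξ (-q - 1) = (-q)⁻¹ • (D.bernstein (-q) *ᵥ momentVec P ξ (-q)) := by
  -- The tail moment of order `-q` involves only the already finite vector `N(-q)`, so its
  -- derivative in `t` is known.
  have htail : ∀ i (t : ℝ≥0), ∫⁻ ω, tailFunctional ξ t ω ^ (-q) ∂(P 0 i) =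
      ∑ j, typeExp P ξ J q i j t * moment P ξ (-q) j := fun i t => by
    rw [← h.lintegral_exp_mul_moment]
    refine lintegral_congr fun ω => ?_
    rw [h.tailFunctional_rpow ω t.coe_nonneg, neg_neg, Real.toNNReal_coe]
  have htfin : ∀ i (t : ℝ≥0), ∫⁻ ω, tailFunctional ξ t ω ^ (-q) ∂(P 0 i) ≠ ∞ := fun i t => by
    rw [htail]
    exact (ENNReal.sum_lt_top.2 fun j _ =>
      ENNReal.mul_lt_top (h.typeExp_lt_top hpar hq.le hqQ hQ i j t) (hmom j)).ne
  have htm : ∀ t : ℝ≥0, Measurable fun ω => tailFunctional ξ t ω ^ (-q) := fun t =>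
    (h.measurable_tailFunctional.comp (measurable_id.prodMk measurable_const)).pow_const _
  have hint : ∀ i (t : ℝ≥0),
      Integrable (fun ω => (tailFunctional ξ t ω).toReal ^ (-q)) (P 0 i) := fun i t => by
    simp only [ENNReal.toReal_rpow]
    exact integrable_toReal_of_lintegral_ne_top (htm t).aemeasurable (htfin i t)
  have hval : ∀ i (t : ℝ≥0), ∫ ω, (tailFunctional ξ t ω).toReal ^ (-q) ∂(P 0 i) =
      ∑ j, (typeExp P ξ J q i j t).toReal * momentVec P ξ (-q) j := fun i t => by
    simp only [ENNReal.toReal_rpow]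
    rw [integral_toReal (htm t).aemeasurable (ae_lt_top (htm t) (htfin i t)), htail,
      ENNReal.toReal_sum fun j _ => (ENNReal.mul_lt_top
        (h.typeExp_lt_top hpar hq.le hqQ hQ i j t) (hmom j)).ne]
    simp only [ENNReal.toReal_mul, momentVec]
  have hint0 : ∀ i, Integrable (fun ω => (expFunctional ξ ω).toReal ^ (-q)) (P 0 i) := fun i => by
    simpa [tailFunctional_zero] using hint i 0
  have hval0 : ∀ i, ∫ ω, (expFunctional ξ ω).toReal ^ (-q) ∂(P 0 i) = momentVec P ξ (-q) i :=
    fun i => by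
      simp only [ENNReal.toReal_rpow]
      have hm := h.measurable_expFunctional.pow_const (-q)
      exact integral_toReal hm.aemeasurable (ae_lt_top hm (hmom i).ne)
  refine h.moment_eq_of_tendsto hpar hq.le hqQ hQ hfin (φ := fun x => -q⁻¹ * x ^ (-q))
    (fun x hx => ?_) (fun i t => ((hint0 i).const_mul _).sub ((hint i t).const_mul _))
    (fun i => ?_)
  · have := (Real.hasDerivAt_rpow_const (p := -q) (Or.inl hx.ne')).const_mul (-q⁻¹)
    rwa [← mul_assoc, neg_mul_neg, inv_mul_cancel₀ hq.ne', one_mul] at this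
  · have hlim := (tendsto_finsetSum Finset.univ fun j (_ : j ∈ Finset.univ) =>
      (h.tendsto_typeExp_div hpar hq.le hqQ hQ i j).mul_const (momentVec P ξ (-q) j)).const_mul q⁻¹
    convert hlim using 1
    · ext t
      rw [integral_sub ((hint0 i).const_mul _) ((hint i t).const_mul _), integral_const_mul,
        integral_const_mul, hval, hval0]
      simp only [div_mul_eq_mul_div, sub_mul, ite_mul, one_mul, zero_mul]
      rw [← Finset.sum_div, Finset.sum_sub_distrib, Finset.sum_ite_eq]
      simp only [Finset.mem_univ, if_true]
      ring
    · simp only [Pi.smul_apply, Matrix.mulVec, dotProduct, smul_eq_mul, neg_mul,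
        Finset.sum_neg_distrib, inv_neg, mul_neg]

/-- The base of the recursion: `N(-1) = Φ'(0) 1 - Λ E[ln I]`. -/
theorem moment_neg_one (h : IsMAP P ξ J) (hpar : HasParameters P ξ J D) {Q : ℝ}
    (hQ0 : 0 < Q) (hQ : D.ExpMoment Q)
    (hfin : ∀ i, ∀ᵐ ω ∂(P 0 i), expFunctional ξ ω < ∞)
    (hlog : ∀ i, Integrable (fun ω => Real.log (expFunctional ξ ω).toReal) (P 0 i)) :
    (∀ i, moment P ξ (-1) i < ∞) ∧
      momentVec P ξ (-1) = D.bernsteinDeriv *ᵥ (fun _ => 1) - D.rate *ᵥ logMoment P ξ := by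
  have hprob := h.prob
  have hgm : Measurable fun x : ℝ≥0 → ℝ × Fin K => Real.log (pathFunctional x).toReal :=
    Real.measurable_log.comp measurable_pathFunctional.ennreal_toReal
  have hgi : ∀ j, Integrable (fun ω => Real.log (pathFunctional (mapPath ξ J ω)).toReal) (P 0 j) :=
    fun j => by simpa only [h.expFunctional_eq] using hlog j
  -- The logarithm turns self-similarity into a sum: `-ξ_t` yields `Φ'(0)1`, the fresh copy yields
  -- the `Λ` term.
  have hsplit : ∀ i (t : ℝ≥0), (fun ω => Real.log (tailFunctional ξ t ω).toReal) =ᵐ[P 0 i]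
      fun ω => -ξ t ω + Real.log (pathFunctional (shiftedPath ξ J t ω)).toReal := fun i t => by
    filter_upwards [hfin i] with ω hω
    have h0 := ENNReal.toReal_pos (h.tailFunctional_pos t ω).ne' (tailFunctional_lt_top hω t.coe_nonneg).ne
    rw [h.tailFunctional_eq t.coe_nonneg ω, ENNReal.toReal_mul, discount,
      ENNReal.toReal_ofReal (Real.exp_pos _).le] at h0 ⊢
    rw [Real.log_mul (Real.exp_pos _).ne' (right_ne_zero_of_mul h0.ne'), Real.log_exp]
    simp
  have hti : ∀ i (t : ℝ≥0), Integrable (fun ω => Real.log (tailFunctional ξ t ω).toReal) (P 0 i) :=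
    fun i t => ((h.integrable_pos hpar hQ0 hQ t i).neg.add
      (h.integral_shiftedPath i t hgm hgi).1).congr (hsplit i t).symm
  have hval : ∀ i (t : ℝ≥0), ∫ ω, Real.log (tailFunctional ξ t ω).toReal ∂(P 0 i) =
      -(∑ j, ∫ ω in {ω | J t ω = j}, ξ t ω ∂(P 0 i)) +
        ∑ j, (typeExp P ξ J 0 i j t).toReal * logMoment P ξ j := fun i t => by
    have hneg : Integrable (fun ω => -ξ t ω) (P 0 i) := (h.integrable_pos hpar hQ0 hQ t i).neg
    rw [integral_congr_ae (hsplit i t), integral_add hneg (h.integral_shiftedPath i t hgm hgi).1, integral_neg,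
      (h.integral_shiftedPath i t hgm hgi).2,
      h.integral_eq_sum_type i t (h.integrable_pos hpar hQ0 hQ t i)]
    simp only [logMoment, h.expFunctional_eq]
  have key := h.moment_eq_of_tendsto hpar le_rfl hQ0 hQ hfin (φ := Real.log)
    (v := D.bernsteinDeriv *ᵥ (fun _ => 1) - D.rate *ᵥ logMoment P ξ)
    (fun x hx => by
      rw [neg_zero, zero_sub, Real.rpow_neg_one]
      exact Real.hasDerivAt_log hx.ne')
    (fun i t => (hlog i).sub (hti i t)) (fun i => ?_)
  · simpa using key
  · have hlim := (tendsto_finsetSum Finset.univ fun j (_ : j ∈ Finset.univ) =>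
      h.tendsto_pos_type hpar hQ0 hQ i j).sub (tendsto_finsetSum Finset.univ
        fun j (_ : j ∈ Finset.univ) =>
          (h.tendsto_typeExp_div hpar le_rfl hQ0 hQ i j).mul_const (logMoment P ξ j))
    convert hlim using 1
    · ext t
      rw [integral_sub (hlog i) (hti i t), hval]
      simp only [div_mul_eq_mul_div, sub_mul, ite_mul, one_mul, zero_mul]
      rw [← Finset.sum_div, ← Finset.sum_div, Finset.sum_sub_distrib, Finset.sum_ite_eq]
      simp only [Finset.mem_univ, if_true, logMoment]
      ring
    · simp [Matrix.mulVec, dotProduct, MAPData.bernstein_zero]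

end IsMAP

end

/-! ### Moments as a generating function of `ln I`, and iteration -/

section

variable {K : ℕ} {Ω : Type*} [MeasurableSpace Ω]

namespace IsMAP

variable {P : ℝ → Fin K → Measure Ω} {ξ : ℝ≥0 → Ω → ℝ} {J : ℝ≥0 → Ω → Fin K} {D : MAPData K}

theorem measurable_log_expFunctional (h : IsMAP P ξ J) :
    Measurable fun ω => Real.log (expFunctional ξ ω).toReal :=
  Real.measurable_log.comp h.measurable_expFunctional.ennreal_toReal

theorem expFunctional_rpow (h : IsMAP P ξ J) {ω : Ω} (hω : expFunctional ξ ω < ∞) (p : ℝ) :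
    expFunctional ξ ω ^ p =
      ENNReal.ofReal (Real.exp (p * Real.log (expFunctional ξ ω).toReal)) := by
  have h0 := ENNReal.toReal_pos (h.expFunctional_pos ω).ne' hω.ne
  rw [mul_comm, Real.exp_mul, Real.exp_log h0, ← ENNReal.ofReal_rpow_of_pos h0,
    ENNReal.ofReal_toReal hω.ne]

theorem moment_eq_lintegral_exp (h : IsMAP P ξ J) {i : Fin K}
    (hfin : ∀ᵐ ω ∂(P 0 i), expFunctional ξ ω < ∞) (p : ℝ) :
    moment P ξ p i =
      ∫⁻ ω, ENNReal.ofReal (Real.exp (p * Real.log (expFunctional ξ ω).toReal)) ∂(P 0 i) := by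
  refine lintegral_congr_ae ?_
  filter_upwards [hfin] with ω hω using h.expFunctional_rpow hω p

theorem moment_lt_top_iff (h : IsMAP P ξ J) {i : Fin K}
    (hfin : ∀ᵐ ω ∂(P 0 i), expFunctional ξ ω < ∞) (p : ℝ) :
    moment P ξ p i < ∞ ↔
      p ∈ ProbabilityTheory.integrableExpSet
        (fun ω => Real.log (expFunctional ξ ω).toReal) (P 0 i) := by
  rw [h.moment_eq_lintegral_exp hfin,
    ← hasFiniteIntegral_iff_ofReal (ae_of_all _ fun _ => (Real.exp_pos _).le)]
  exact ⟨fun hf => ⟨(Real.measurable_exp.comp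
    (h.measurable_log_expFunctional.const_mul p)).aestronglyMeasurable, hf⟩, fun hi => hi.2⟩

/-- Reading `I^p` as `e^{p ln I}` makes differentiability at `0` and integrability of `ln I` general
facts about moment generating functions. -/
theorem momentVec_eq_mgf (h : IsMAP P ξ J) {i : Fin K}
    (hfin : ∀ᵐ ω ∂(P 0 i), expFunctional ξ ω < ∞) (p : ℝ) :
    momentVec P ξ p i =
      ProbabilityTheory.mgf (fun ω => Real.log (expFunctional ξ ω).toReal) (P 0 i) p := by
  rw [momentVec, h.moment_eq_lintegral_exp hfin, ProbabilityTheory.mgf,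
    integral_eq_lintegral_of_nonneg_ae (ae_of_all _ fun _ => (Real.exp_pos _).le)
      (Real.measurable_exp.comp (h.measurable_log_expFunctional.const_mul p)).aestronglyMeasurable]

/-- The domain is convex. It contains `1` since `E[I] < ∞`, and `-Q/2` since `I ≥ e^{-ξ_1}` and
`ξ_1` has an exponential moment of order `Q/2`. -/
theorem zero_mem_interior_integrableExpSet (h : IsMAP P ξ J) (hpar : HasParameters P ξ J D)
    {Q : ℝ} (hQ0 : 0 < Q) (hQ : D.ExpMoment Q) {i : Fin K}
    (hI : ∫⁻ ω, expFunctional ξ ω ∂(P 0 i) < ∞) :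
    0 ∈ interior (ProbabilityTheory.integrableExpSet
      (fun ω => Real.log (expFunctional ξ ω).toReal) (P 0 i)) := by
  have hfin := ae_lt_top h.measurable_expFunctional hI.ne
  have h1 : (1 : ℝ) ∈ ProbabilityTheory.integrableExpSet
      (fun ω => Real.log (expFunctional ξ ω).toReal) (P 0 i) := by
    rw [← h.moment_lt_top_iff hfin, moment]
    simpa using hI
  have h2 : -(Q / 2) ∈ ProbabilityTheory.integrableExpSet
      (fun ω => Real.log (expFunctional ξ ω).toReal) (P 0 i) := by
    rw [← h.moment_lt_top_iff hfin]
    obtain ⟨C, -, hC⟩ := h.lintegral_exp_le hpar (half_pos hQ0).le (half_lt_self hQ0) hQ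
    refine lt_of_le_of_lt (lintegral_mono fun ω => ?_) ((hC 1 i).trans_lt ENNReal.ofReal_lt_top)
    calc expFunctional ξ ω ^ (-(Q / 2)) ≤ ENNReal.ofReal (Real.exp (-ξ 1 ω)) ^ (-(Q / 2)) := by
          rw [ENNReal.rpow_neg, ENNReal.rpow_neg, ENNReal.inv_le_inv]
          exact ENNReal.rpow_le_rpow (h.ofReal_exp_neg_le_expFunctional ω) (by linarith)
      _ = ENNReal.ofReal (Real.exp (Q / 2 * ξ 1 ω)) := by
          rw [ofReal_exp_rpow, neg_mul_neg]
  refine mem_interior.2 ⟨Set.Ioo (-(Q / 2)) 1, fun p hp => ?_, isOpen_Ioo, by simp [hQ0]⟩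
  exact ProbabilityTheory.convex_integrableExpSet.ordConnected.out h2 h1 ⟨hp.1.le, hp.2.le⟩

end IsMAP

theorem List.prod_map_range_succ_front {M : Type*} [Monoid M] (f : ℕ → M) (n : ℕ) :
    ((List.range (n + 1)).map f).prod =
      f 0 * ((List.range n).map fun l => f (l + 1)).prod := by
  rw [List.range_succ_eq_map, List.map_cons, List.prod_cons, List.map_map]
  rfl

namespace IsMAP

variable {P : ℝ → Fin K → Measure Ω} {ξ : ℝ≥0 → Ω → ℝ} {J : ℝ≥0 → Ω → Fin K} {D : MAPData K}

/-- Negative integer moments, by iteration of the recursion from the moment of order `-1`. -/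
theorem moment_neg_nat (h : IsMAP P ξ J) (hpar : HasParameters P ξ J D)
    (hfin : ∀ i, ∀ᵐ ω ∂(P 0 i), expFunctional ξ ω < ∞)
    (hbase : ∀ i, moment P ξ (-1) i < ∞) (n : ℕ)
    (hn : D.pLower < ((-(n : ℝ) : ℝ) : EReal)) :
    (∀ i, moment P ξ (-((n : ℝ) + 1)) i < ∞) ∧
      momentVec P ξ (-((n : ℝ) + 1)) = ((-1 : ℝ) ^ n / (n.factorial : ℝ)) •
        (((List.range n).map fun l : ℕ => D.bernstein (-(n : ℝ) + (l : ℝ))).prod *ᵥ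
          momentVec P ξ (-1)) := by
  induction n with
  | zero => simpa using hbase
  | succ n ih =>
    have hlt : D.pLower < ((-(n : ℝ) : ℝ) : EReal) := hn.trans (by
      rw [EReal.coe_lt_coe_iff]; push_cast; linarith)
    obtain ⟨ih1, ih2⟩ := ih hlt
    -- The step to order `-(n + 2)` uses the recursion at `q = n + 1`; this is where the strict
    -- inequality on `pLower` enters.
    obtain ⟨Q, hQ, hQm⟩ := D.exists_expMoment (by push_cast; linarith [n.cast_nonneg (α := ℝ)]) hn
    rw [neg_neg] at hQ
    push_cast at hQ
    have hpos : (0 : ℝ) < n + 1 := by positivity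
    obtain ⟨h1, h2⟩ := h.moment_step hpar hpos hQ hQm hfin ih1
    have hexp : -(((n + 1 : ℕ) : ℝ) + 1) = -((n : ℝ) + 1) - 1 := by push_cast; ring
    rw [hexp]
    refine ⟨h1, ?_⟩
    rw [h2, ih2, List.prod_map_range_succ_front, Matrix.mulVec_smul, smul_smul,
      ← Matrix.mulVec_mulVec]
    have hlist : (fun l : ℕ => D.bernstein (-((n + 1 : ℕ) : ℝ) + ((l + 1 : ℕ) : ℝ))) =
        fun l : ℕ => D.bernstein (-(n : ℝ) + (l : ℝ)) := by
      ext1 l; congr 1; push_cast; ring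
    rw [hlist]
    congr 1
    · rw [Nat.factorial_succ, pow_succ]
      push_cast
      field_simp
    · push_cast; simp

end IsMAP

end

/-! ### Assembly -/

theorem mainTheorem3 {K : ℕ} {Ω : Type*} [MeasurableSpace Ω]
    (P : ℝ → Fin K → Measure Ω) (ξ : ℝ≥0 → Ω → ℝ) (J : ℝ≥0 → Ω → Fin K) (D : MAPData K)
    (hMAP : IsMAP P ξ J) (hpar : HasParameters P ξ J D)
    (hirr : D.Irreducible) (hnc : D.NonConstant) (hp : D.pLower < 0) :
    (∀ i, ∀ᵐ ω ∂(P 0 i), 0 < expFunctional ξ ω ∧ expFunctional ξ ω < ∞) ∧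
    (∃ dΦ : Matrix (Fin K) (Fin K) ℝ,
      (∀ i j, HasDerivAt (fun p => D.bernstein p i j) (dΦ i j) 0) ∧
      (∀ i t, Integrable (ξ t) (P 0 i)) ∧
      (∀ i j, Tendsto (fun t : ℝ≥0 => (∫ ω in {ω | J t ω = j}, ξ t ω ∂(P 0 i)) / (t : ℝ))
        (𝓝[>] 0) (𝓝 (dΦ i j))) ∧
      (∀ i, Integrable (fun ω => Real.log (expFunctional ξ ω).toReal) (P 0 i)) ∧
      (∀ i, ∀ᶠ p in 𝓝 (0 : ℝ), moment P ξ p i < ∞) ∧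
      (∀ i, HasDerivAt (fun p => momentVec P ξ p i) (logMoment P ξ i) 0) ∧
      (∀ i, moment P ξ (-1) i < ∞) ∧
      momentVec P ξ (-1) = dΦ *ᵥ (fun _ => 1) - D.rate *ᵥ logMoment P ξ) ∧
    (∀ k : ℤ, k < 0 → D.pLower - 1 < ((k : ℝ) : EReal) →
      (∀ i, moment P ξ (k : ℝ) i < ∞) ∧
      momentVec P ξ (k : ℝ) =
        ((-1 : ℝ) ^ (k + 1) / ((k.natAbs - 1).factorial : ℝ)) •
          (((List.range (k.natAbs - 1)).map fun l : ℕ =>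
              D.bernstein ((k : ℝ) + 1 + (l : ℝ))).prod *ᵥ momentVec P ξ (-1))) := by
  have hI := hMAP.lintegral_expFunctional_lt_top hpar hirr hnc
  have hfin := hMAP.ae_expFunctional_lt_top hpar hirr hnc
  obtain ⟨Q, hQ0, hQ⟩ := D.exists_expMoment le_rfl (by simpa using hp)
  rw [neg_zero] at hQ0
  have hint := fun i => hMAP.zero_mem_interior_integrableExpSet hpar hQ0 hQ (hI i)
  have hlog : ∀ i, Integrable (fun ω => Real.log (expFunctional ξ ω).toReal) (P 0 i) := fun i =>
    ProbabilityTheory.integrable_of_mem_interior_integrableExpSet (hint i)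
  obtain ⟨hbase, hbase'⟩ := hMAP.moment_neg_one hpar hQ0 hQ hfin hlog
  refine ⟨fun i => ?_, ⟨D.bernsteinDeriv, hQ.hasDerivAt_bernstein hQ0,
    fun i t => hMAP.integrable_pos hpar hQ0 hQ t i, hMAP.tendsto_pos_type hpar hQ0 hQ, hlog,
    fun i => ?_, fun i => ?_, hbase, hbase'⟩, fun k hk hkp => ?_⟩
  · filter_upwards [hfin i] with ω hω using ⟨hMAP.expFunctional_pos ω, hω⟩
  · filter_upwards [mem_interior_iff_mem_nhds.1 (hint i)] with p hp
    exact (hMAP.moment_lt_top_iff (hfin i) p).2 hp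
  · rw [funext (hMAP.momentVec_eq_mgf (hfin i))]
    simpa [logMoment] using ProbabilityTheory.hasDerivAt_mgf (hint i)
  -- With `k = -(n + 1)` the condition `k > pLower - 1` is exactly `pLower < -n`, and the sign
  -- `(-1)^{k+1}` equals `(-1)^n`.
  · obtain ⟨n, rfl⟩ : ∃ n : ℕ, k = -((n : ℤ) + 1) := ⟨(-k - 1).toNat, by omega⟩
    have hnat : (-((n : ℤ) + 1)).natAbs - 1 = n := by omega
    have hcast : ((-((n : ℤ) + 1) : ℤ) : ℝ) = -((n : ℝ) + 1) := by push_cast; ring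
    have hsign : (-1 : ℝ) ^ (-((n : ℤ) + 1) + 1) = (-1) ^ n := by
      rw [neg_add, add_assoc, neg_add_cancel, add_zero, zpow_neg, zpow_natCast, ← inv_pow]
      norm_num
    have hn : D.pLower < ((-(n : ℝ) : ℝ) : EReal) := by
      rw [hcast, ← EReal.coe_one, EReal.sub_lt_iff (Or.inl (EReal.coe_ne_bot 1)) (Or.inl (EReal.coe_ne_top 1))] at hkp
      refine hkp.trans_eq ?_
      rw [← EReal.coe_add]
      congr 1
      ring
    rw [hnat, hcast, hsign]
    have hshift : ∀ l : ℕ, -((n : ℝ) + 1) + 1 + (l : ℝ) = -(n : ℝ) + (l : ℝ) := fun l => by ring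
    simp only [hshift]
    exact hMAP.moment_neg_nat hpar hfin hbase n hn
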